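/- Consider the Burgers equation $L[u]:=u_t+uu_x+u_{xx}=0$ and let $\Omega\subset\mathbb R^2$ be an open simply connected set of values of $(t,x)$. A vector field $Q=\tau\partial_t+\xi\partial_x+\eta\partial_u$ whose coefficients are smooth functions of $(t,x,u)$, $(t,x)\in\Omega$, with $(\tau,\xi)\neq(0,0)$ everywhere, is a \emph{reduction operator} of this equation over $\Omega$ if its second prolongation satisfies $Q_{(2)}L[u]=0$ at all second-order jets over $\Omega$ with $L[u]=0$, $Q[u]=0$, $D_tQ[u]=0$, $D_xQ[u]=0$, where $Q[u]=\eta-\tau u_t-\xi u_x$. Let $\mathcal R(\Omega)$ be the set of reduction operators over $\Omega$ of the no-go form $$Q=\partial_t+\Bigl(-\tfrac12u+\xi^0\Bigr)\partial_x+\Bigl(\tfrac14u^3-\tfrac{\xi^0}{2}u^2+\eta^1u+\eta^0\Bigr)\partial_u,$$ where $\xi^0,\eta^1,\eta^0$ are smooth functions of $(t,x)$ on $\Omega$. For $Q\in\mathcal R(\Omega)$ let $\mathcal I(Q)$ be the family of all $Q$-invariant solutions of the Burgers equation, i.e. of all pairs $(U,u)$ where $U\subseteq\Omega$ is a nonempty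 connected open set and $u$ is a smooth function on $U$ with $L[u]=0$ and $Q[u]=0$ on $U$. Let $\mathcal T(\Omega)$ be the set of triples $\bar v=(v^1,v^2,v^3)$ of smooth solutions of the heat equation $v_t+v_{xx}=0$ on $\Omega$ whose Wronskian $W(\bar v)=|\bar v,\bar v_x,\bar v_{xx}|$ vanishes nowhere on $\Omega$ (in particular, $v^1,v^2,v^3$ are linearly independent). For $\bar v\in\mathcal T(\Omega)$ let $Q_{\bar v}$ be the vector field of the no-go form with $$\xi^0=\frac{(W(\bar v))_x}{W(\bar v)},\qquad \eta^1=\frac{|\bar v,\bar v_{xx},\bar v_{xxx}|}{W(\bar v)},\qquad \eta^0=-2\,\frac{W(\bar v_x)}{W(\bar v)},$$ and let $\mathcal F(\bar v)$ be the family of the functions $$u_c=2\,\frac{c_1v^1_x+c_2v^2_x+c_3v^3_x}{c_1v^1+c_2v^2+c_3v^3},\qquad c=(c_1,c_2,c_3)\in\mathbb R^3\setminus\{0\},$$ considered on all nonempty connected open sets $U\subseteq\Omega$ on which the denominator does not vanish. Then: 1. For every $\bar v\in\mathcal T(\Omega)$ one has $Q_{\bar v}\in\mathcal R(\Omega)$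 and $\mathcal I(Q_{\bar v})=\mathcal F(\bar v)$. 2. Every $Q\in\mathcal R(\Omega)$ is equal to $Q_{\bar v}$ for some $\bar v\in\mathcal T(\Omega)$. 3. For $\bar v,\bar w\in\mathcal T(\Omega)$ the conditions $\mathcal F(\bar v)=\mathcal F(\bar w)$, $Q_{\bar v}=Q_{\bar w}$, and $\bar w=A\bar v$ on $\Omega$ for some constant nondegenerate $3\times3$ matrix $A$ are equivalent. 4. Consequently, $Q\mapsto\mathcal I(Q)$ is a bijection from $\mathcal R(\Omega)$ onto $\{\mathcal F(\bar v):\bar v\in\mathcal T(\Omega)\}$, with inverse $\mathcal F(\bar v)\mapsto Q_{\bar v}$. 5. Each family $\mathcal F(\bar v)$ has exactly two essential parameters: for every $c\ne0$ there is a nonempty connected open $U\subseteq\Omega$ on which $c_1v^1+c_2v^2+c_3v^3$ does not vanish, and if $c,d\neq0$ and both denominators do not vanish on a nonempty connected open $U\subseteq\Omega$, then $u_c=u_d$ on $U$ if and only if $d=kc$ for some constant $k\ne0$. -/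

import Mathlib

open scoped ContDiff

noncomputable section

namespace Burgers

/-- The partial derivative with respect to `t` of a function of `(t, x)`. -/
def dt (f : ℝ × ℝ → ℝ) (p : ℝ × ℝ) : ℝ := fderiv ℝ f p (1, 0)

/-- The partial derivative with respect to `x` of a function of `(t, x)`. -/
def dx (f : ℝ × ℝ → ℝ) (p : ℝ × ℝ) : ℝ := fderiv ℝ f p (0, 1)

/-- A point of the second-order jet space, with coordinates
`(t, x, u, u_t, u_x, u_tt, u_tx, u_xx)`. -/
structure Jet where
  t : ℝ
  x : ℝ
  u : ℝ
  ut : ℝ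
  ux : ℝ
  utt : ℝ
  utx : ℝ
  uxx : ℝ

/-- The second-order jet at `p = (t, x)` of a function `u` of `(t, x)`. -/
def jet (u : ℝ × ℝ → ℝ) (p : ℝ × ℝ) : Jet where
  t := p.1
  x := p.2
  u := u p
  ut := dt u p
  ux := dx u p
  utt := dt (dt u) p
  utx := dx (dt u) p
  uxx := dx (dx u) p

/-- The left-hand side `L[u] = u_t + u u_x + u_xx` of the Burgers equation. -/
def burgersL (j : Jet) : ℝ := j.ut + j.u * j.ux + j.uxx

/-- The point `(t, x, u)` below a jet. -/
def Jet.base (j : Jet) : ℝ × ℝ × ℝ := (j.t, j.x, j.u)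

/-- The partial derivative with respect to `t` of a function of `(t, x, u)`. -/
def pt (f : ℝ × ℝ × ℝ → ℝ) (z : ℝ × ℝ × ℝ) : ℝ := fderiv ℝ f z (1, 0, 0)

/-- The partial derivative with respect to `x` of a function of `(t, x, u)`. -/
def px (f : ℝ × ℝ × ℝ → ℝ) (z : ℝ × ℝ × ℝ) : ℝ := fderiv ℝ f z (0, 1, 0)

/-- The partial derivative with respect to `u` of a function of `(t, x, u)`. -/
def pu (f : ℝ × ℝ × ℝ → ℝ) (z : ℝ × ℝ × ℝ) : ℝ := fderiv ℝ f z (0, 0, 1)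

/-- The total derivative `D_t f` of a function `f` of `(t, x, u)`. -/
def totalT (f : ℝ × ℝ × ℝ → ℝ) (j : Jet) : ℝ := pt f j.base + pu f j.base * j.ut

/-- The total derivative `D_x f` of a function `f` of `(t, x, u)`. -/
def totalX (f : ℝ × ℝ × ℝ → ℝ) (j : Jet) : ℝ := px f j.base + pu f j.base * j.ux

/-- The second total derivative `D_x D_x f` of a function `f` of `(t, x, u)`. -/
def totalXX (f : ℝ × ℝ × ℝ → ℝ) (j : Jet) : ℝ :=
  px (px f) j.base + 2 * pu (px f) j.base * j.ux + pu (pu f) j.base * j.ux ^ 2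
    + pu f j.base * j.uxx

/-- A vector field `τ ∂_t + ξ ∂_x + η ∂_u` with coefficients depending on `(t, x, u)`. -/
structure VField where
  τ : ℝ × ℝ × ℝ → ℝ
  ξ : ℝ × ℝ × ℝ → ℝ
  η : ℝ × ℝ × ℝ → ℝ

namespace VField

/-- The characteristic `Q[u] = η - τ u_t - ξ u_x`. -/
def char (Q : VField) (j : Jet) : ℝ :=
  Q.η j.base - Q.τ j.base * j.ut - Q.ξ j.base * j.ux

/-- The differential consequence `D_t Q[u]`. -/
def charT (Q : VField) (j : Jet) : ℝ :=
  totalT Q.η j - totalT Q.τ j * j.ut - Q.τ j.base * j.utt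
    - totalT Q.ξ j * j.ux - Q.ξ j.base * j.utx

/-- The differential consequence `D_x Q[u]`. -/
def charX (Q : VField) (j : Jet) : ℝ :=
  totalX Q.η j - totalX Q.τ j * j.ut - Q.τ j.base * j.utx
    - totalX Q.ξ j * j.ux - Q.ξ j.base * j.uxx

/-- The coefficient of `∂_{u_t}` in the prolongation of `Q`. -/
def prolT (Q : VField) (j : Jet) : ℝ :=
  totalT Q.η j - totalT Q.τ j * j.ut - totalT Q.ξ j * j.ux

/-- The coefficient of `∂_{u_x}` in the prolongation of `Q`. -/
def prolX (Q : VField) (j : Jet) : ℝ :=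
  totalX Q.η j - totalX Q.τ j * j.ut - totalX Q.ξ j * j.ux

/-- The coefficient of `∂_{u_xx}` in the second prolongation of `Q`, that is,
`D_x D_x Q[u] + τ u_txx + ξ u_xxx`. -/
def prolXX (Q : VField) (j : Jet) : ℝ :=
  totalXX Q.η j - totalXX Q.τ j * j.ut - totalXX Q.ξ j * j.ux
    - 2 * totalX Q.τ j * j.utx - 2 * totalX Q.ξ j * j.uxx

/-- The second prolongation of `Q` applied to `L[u] = u_t + u u_x + u_xx`. -/
def prolongL (Q : VField) (j : Jet) : ℝ :=
  Q.η j.base * j.ux + Q.prolT j + j.u * Q.prolX j + Q.prolXX j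

/-- `Q` is a reduction operator of the Burgers equation over the set `Ω` of values of `(t, x)`:
its coefficients are smooth, `τ` and `ξ` do not vanish simultaneously, and the conditional
invariance criterion holds, i.e. the second prolongation of `Q` annihilates `L[u]` on the set of
jets satisfying `L[u] = 0`, `Q[u] = 0`, `D_t Q[u] = 0` and `D_x Q[u] = 0`. -/
structure IsReductionOperator (Ω : Set (ℝ × ℝ)) (Q : VField) : Prop where
  smooth_τ : ContDiffOn ℝ ∞ Q.τ {z | (z.1, z.2.1) ∈ Ω}
  smooth_ξ : ContDiffOn ℝ ∞ Q.ξ {z | (z.1, z.2.1) ∈ Ω}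
  smooth_η : ContDiffOn ℝ ∞ Q.η {z | (z.1, z.2.1) ∈ Ω}
  nondegenerate : ∀ t x u : ℝ, (t, x) ∈ Ω → Q.τ (t, x, u) ≠ 0 ∨ Q.ξ (t, x, u) ≠ 0
  criterion : ∀ j : Jet, (j.t, j.x) ∈ Ω →
    burgersL j = 0 → Q.char j = 0 → Q.charT j = 0 → Q.charX j = 0 → Q.prolongL j = 0

end VField

/-- The coefficient functions `ξ⁰, η¹, η⁰` of `(t, x)` in a vector field of the no-go form. -/
@[ext]
structure Coeffs where
  ξ₀ : ℝ × ℝ → ℝ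
  η₁ : ℝ × ℝ → ℝ
  η₀ : ℝ × ℝ → ℝ

/-- The vector field
`∂_t + (-u/2 + ξ⁰) ∂_x + (u³/4 - ξ⁰ u²/2 + η¹ u + η⁰) ∂_u` of the no-go form. -/
def Coeffs.field (q : Coeffs) : VField where
  τ := fun _ => 1
  ξ := fun z => -(1 / 2) * z.2.2 + q.ξ₀ (z.1, z.2.1)
  η := fun z => 1 / 4 * z.2.2 ^ 3 - q.ξ₀ (z.1, z.2.1) / 2 * z.2.2 ^ 2
    + q.η₁ (z.1, z.2.1) * z.2.2 + q.η₀ (z.1, z.2.1)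

/-- The reduction operators of the no-go form over `Ω`, given by their coefficients: smooth
functions `ξ⁰, η¹, η⁰` on `Ω` for which the vector field of the no-go form is a reduction operator
of the Burgers equation. A function on `Ω` is represented by its extension by zero, so that
equality of two elements is equality of the coefficient functions on `Ω`. -/
structure IsNoGoOperator (Ω : Set (ℝ × ℝ)) (q : Coeffs) : Prop where
  smooth_ξ₀ : ContDiffOn ℝ ∞ q.ξ₀ Ω
  smooth_η₁ : ContDiffOn ℝ ∞ q.η₁ Ω
  smooth_η₀ : ContDiffOn ℝ ∞ q.η₀ Ω
  zero_off : ∀ p, p ∉ Ω → q.ξ₀ p = 0 ∧ q.η₁ p = 0 ∧ q.η₀ p = 0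
  reduction : q.field.IsReductionOperator Ω

/-- `U` is a subdomain of `Ω`: a nonempty connected open subset. -/
def IsSubdomain (Ω U : Set (ℝ × ℝ)) : Prop := U ⊆ Ω ∧ IsOpen U ∧ IsConnected U

/-- The family of all `Q`-invariant solutions of the Burgers equation, where `Q` is the vector
field of the no-go form with coefficients `q`. A solution is a pair `(U, u)` of a subdomain `U`
of `Ω` and a smooth function `u` on `U`; only the values of `u` on `U` matter. -/
def invariantFamily (Ω : Set (ℝ × ℝ)) (q : Coeffs) : Set (Set (ℝ × ℝ) × (ℝ × ℝ → ℝ)) :=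
  {s | IsSubdomain Ω s.1 ∧ ContDiffOn ℝ ∞ s.2 s.1 ∧
    ∀ p ∈ s.1, burgersL (jet s.2 p) = 0 ∧ q.field.char (jet s.2 p) = 0}

/-- The determinant `|a, b, c|` of the matrix with columns `a`, `b`, `c`. -/
def det3 (a b c : Fin 3 → ℝ) : ℝ := Matrix.det (Matrix.of fun i j => ![a, b, c] j i)

/-- The column of the values at `p` of the `k`-th order derivatives in `x` of a triple of
functions of `(t, x)`. -/
def col (v : Fin 3 → ℝ × ℝ → ℝ) (k : ℕ) (p : ℝ × ℝ) : Fin 3 → ℝ := fun i => (dx^[k] (v i)) p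

/-- The Wronskian `W(v) = |v, v_x, v_xx|` in `x` of a triple of functions of `(t, x)`. -/
def wronskian (v : Fin 3 → ℝ × ℝ → ℝ) (p : ℝ × ℝ) : ℝ := det3 (col v 0 p) (col v 1 p) (col v 2 p)

/-- A triple of smooth solutions of the heat equation `v_t + v_xx = 0` on `Ω` whose Wronskian
vanishes nowhere on `Ω` (in particular, the solutions are linearly independent). -/
structure IsHeatTriple (Ω : Set (ℝ × ℝ)) (v : Fin 3 → ℝ × ℝ → ℝ) : Prop where
  smooth : ∀ i, ContDiffOn ℝ ∞ (v i) Ω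
  heat : ∀ i, ∀ p ∈ Ω, dt (v i) p + dx (dx (v i)) p = 0
  wronskian_ne_zero : ∀ p ∈ Ω, wronskian v p ≠ 0

/-- The coefficients, as functions on `Ω`, given by the Wronskian representation
`ξ⁰ = (W(v))_x / W(v)`, `η¹ = |v, v_xx, v_xxx| / W(v)`, `η⁰ = -2 W(v_x) / W(v)`. -/
def wronskianCoeffs (Ω : Set (ℝ × ℝ)) (v : Fin 3 → ℝ × ℝ → ℝ) : Coeffs where
  ξ₀ := Ω.indicator fun p => dx (wronskian v) p / wronskian v p
  η₁ := Ω.indicator fun p => det3 (col v 0 p) (col v 2 p) (col v 3 p) / wronskian v p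
  η₀ := Ω.indicator fun p => -2 * wronskian (fun i => dx (v i)) p / wronskian v p

/-- The denominator `c₁ v¹ + c₂ v² + c₃ v³`. -/
def comb (v : Fin 3 → ℝ × ℝ → ℝ) (c : Fin 3 → ℝ) (p : ℝ × ℝ) : ℝ := ∑ i, c i * v i p

/-- The function `u = 2 (c₁ v¹_x + c₂ v²_x + c₃ v³_x) / (c₁ v¹ + c₂ v² + c₃ v³)`. -/
def ratio (v : Fin 3 → ℝ × ℝ → ℝ) (c : Fin 3 → ℝ) (p : ℝ × ℝ) : ℝ :=
  2 * (∑ i, c i * dx (v i) p) / comb v c p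

/-- The family of the functions `u = 2 (∑ cᵢ vⁱ_x) / (∑ cᵢ vⁱ)` with constants `cᵢ` that are not
all zero, considered on the subdomains of `Ω` where the denominator does not vanish. -/
def ratioFamily (Ω : Set (ℝ × ℝ)) (v : Fin 3 → ℝ × ℝ → ℝ) :
    Set (Set (ℝ × ℝ) × (ℝ × ℝ → ℝ)) :=
  {s | IsSubdomain Ω s.1 ∧ ∃ c : Fin 3 → ℝ, c ≠ 0 ∧
    ∀ p ∈ s.1, comb v c p ≠ 0 ∧ s.2 p = ratio v c p}

end Burgers

end

/-! The Hopf-Cole substitution `u = 2 w_x / w` linearizes the problem. Together, the Burgers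
equation and invariance under an operator of the no-go form become the overdetermined linear system
`w_t = -w_xx`, `w_xxx = ξ⁰ w_xx - η¹ w_x - (η⁰/2) w`. For `y = (w, w_x, w_xx)` this system reads
`y_x = M y`, `y_t = N y`, a connection on a trivial bundle of rank 3.

On jets satisfying `L = 0` and `Q = 0`, the invariance criterion reduces to a polynomial in `u` and
`u_x` (`prolongL_field`). Its coefficients are three determining equations for `ξ⁰, η¹, η⁰`, and
these say exactly that the connection is flat (`Coeffs.IsDetermining.flat`). Over a simply connected
`Ω` a flat connection has a global parallel frame (`exists_global_parallel`), which yields three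
solutions with nonvanishing Wronskian. By Cramer's rule their third-order equation has the Wronskian
quotients as coefficients, so the operator is the one of this triple. Conversely, three solutions
with nonvanishing Wronskian force the determining equations through the compatibility of the two
linear equations.

An invariant solution `u` on a subdomain `U` gives the section `(1, u/2, u_x/2 + u²/4)`, which is
parallel up to scalar factors. Its coordinates in the parallel frame therefore have constant
direction `c` (`Coeffs.IsProjParallel.exists_const_direction`), whence `u = u_c`. Since only a
direction is needed, `w` is never integrated and `U` may fail to be simply connected.

Finally, the matrix with rows `(vⁱ, vⁱ_x, vⁱ_xx)` is invertible at every point, so members of a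
family realize all values of `(u, u_x)` there. This recovers the operator from the family, and the
same invertibility determines `c` up to a factor. Triples of the same operator are frames of one
connection, hence differ by a constant matrix. -/

section

open Set Filter Topology Metric

/-! ### Gluing over a simply connected space -/

/-- On a simply connected, locally path connected space, a family of group-valued functions on an
open cover whose quotients are locally constant can be glued, after right multiplication by
locally constant functions, to a globally defined function. -/
theorem exists_section_of_locallyConstant_quotients {X G ι : Type*} [TopologicalSpace X]
    [SimplyConnectedSpace X] [LocallyPathConnectedSpace X] [Group G]
    (U : ι → Set X) (hU : ∀ i, IsOpen (U i)) (hcov : ∀ x, ∃ i, x ∈ U i) (g : ι → X → G)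
    (hg : ∀ i j, ∀ x ∈ U i ∩ U j, ∀ᶠ y in 𝓝 x, (g j y)⁻¹ * g i y = (g j x)⁻¹ * g i x) :
    ∃ s : X → G, ∀ i, ∀ x ∈ U i, ∀ᶠ y in 𝓝 x, (g i y)⁻¹ * s y = (g i x)⁻¹ * s x := by
  classical
  -- For discrete `G`, locally constant transition functions are continuous, so they define a fibre
  -- bundle with discrete fibres, that is, a covering.
  let _ : TopologicalSpace G := ⊥
  have _ : DiscreteTopology G := ⟨rfl⟩
  choose idx hidx using hcov
  let Z : FiberBundleCore ι X G :=
    { baseSet := U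
      isOpen_baseSet := hU
      indexAt := idx
      mem_baseSet_at := hidx
      coordChange := fun i j x v => (g j x)⁻¹ * g i x * v
      coordChange_self := fun i x _ v => by simp
      continuousOn_coordChange := by
        rintro i j ⟨x, v⟩ hx
        refine ContinuousAt.continuousWithinAt ?_
        have h1 : ContinuousAt (fun p : X × G => (((g j x)⁻¹ * g i x) * p.2 : G)) (x, v) :=
          (continuous_of_discreteTopology (f := fun w : G => (g j x)⁻¹ * g i x * w)).continuousAt.comp
            continuousAt_snd
        refine h1.congr ?_
        have h2 := (continuousAt_fst (p := (x, v))).eventually (hg i j x hx.1)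
        filter_upwards [h2] with p hp
        rw [hp]
      coordChange_comp := fun i j k x _ v => by group }
  let val : Z.TotalSpace → G := fun z => z.2
  have hcovmap : IsCoveringMap (Bundle.TotalSpace.proj : Z.TotalSpace → X) :=
    FiberBundle.isCoveringMap
  obtain ⟨x₀⟩ : Nonempty X := inferInstance
  -- A lift of the identity map along the covering is a global section; simple connectedness
  -- provides it.
  obtain ⟨F, ⟨-, hF⟩, -⟩ := hcovmap.existsUnique_continuousMap_lifts (ContinuousMap.id X) x₀
    (⟨x₀, (1 : G)⟩ : Z.TotalSpace) rfl
  have hFx : ∀ x, (F x).1 = x := fun x => congrFun hF x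
  -- The product of `g i` with the fibre coordinate in chart `i` does not depend on the chart. In a
  -- fixed chart that coordinate is continuous into a discrete space, hence locally constant.
  refine ⟨fun x => g (idx x) x * val (F x), fun i x hx => ?_⟩
  have key : ∀ y, (g i y)⁻¹ * (g (idx y) y * val (F y)) = (Z.localTriv i (F y)).2 := by
    intro y
    have : (Z.localTriv i (F y)).2 = (g i (F y).1)⁻¹ * g (idx (F y).1) (F y).1 * val (F y) := rfl
    rw [this, hFx y, mul_assoc]
  have hcont : ContinuousAt (fun y => (Z.localTriv i (F y)).2) x := by
    refine continuousAt_snd.comp (ContinuousAt.comp (f := F) ?_ F.continuous.continuousAt)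
    refine (Z.localTriv i).continuousAt ?_
    change (F x).1 ∈ U i
    rw [hFx x]; exact hx
  have := hcont.eventually (isOpen_discrete {(Z.localTriv i (F x)).2} |>.mem_nhds rfl)
  filter_upwards [this] with y hy
  rw [key, key]; exact hy

/-! ### Local parallel frames from a Volterra equation -/

/-- Past the point at distance `R` from `a` the integral no longer changes. The bound is thus
uniform in `x`, which makes the Volterra operator bounded on functions over the whole plane. -/
theorem norm_intervalIntegral_le_of_eq_zero_off {E : Type*} [NormedAddCommGroup E]
    [NormedSpace ℝ E] {g : ℝ → E} (hg : Continuous g) {a C R : ℝ} (hR : 0 ≤ R)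
    (hC : ∀ s, ‖g s‖ ≤ C) (h0 : ∀ s, R < |s - a| → g s = 0) (x : ℝ) :
    ‖∫ s in a..x, g s‖ ≤ C * R := by
  have hC0 : 0 ≤ C := (norm_nonneg _).trans (hC a)
  have hle : ∀ y, |y - a| ≤ R → ‖∫ s in a..y, g s‖ ≤ C * R := fun y hy =>
    (intervalIntegral.norm_integral_le_of_norm_le_const fun s _ => hC s).trans
      (mul_le_mul_of_nonneg_left hy hC0)
  rcases le_or_gt |x - a| R with hx | hx
  · exact hle x hx
  obtain ⟨y, hy, hyx⟩ : ∃ y, |y - a| ≤ R ∧ ∀ s ∈ Set.uIoc y x, R < |s - a| ∨ s = y ∨ s = x := by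
    rcases le_total a x with hax | hax
    · rw [abs_of_nonneg (by linarith)] at hx
      refine ⟨a + R, by simp [abs_of_nonneg hR], fun s hs => ?_⟩
      rw [uIoc_of_le (by linarith)] at hs
      left
      exact lt_of_lt_of_le (by linarith [hs.1]) (le_abs_self _)
    · rw [abs_of_nonpos (by linarith)] at hx
      refine ⟨a - R, by simp [abs_of_nonneg hR], fun s hs => ?_⟩
      rw [uIoc_of_ge (by linarith)] at hs
      rcases eq_or_lt_of_le hs.2 with h | h
      · exact Or.inr (Or.inl h)
      · left
        exact lt_of_lt_of_le (by linarith) (neg_le_abs _)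
  have h1 : ∫ s in y..x, g s = 0 := by
    apply intervalIntegral.integral_zero_ae
    have : ∀ᵐ s : ℝ, s ∉ ({y, x} : Set ℝ) :=
      MeasureTheory.measure_eq_zero_iff_ae_notMem.1 ((Set.toFinite _).measure_zero _)
    filter_upwards [this] with s hs hsx
    rcases hyx s hsx with h | h | h
    · exact h0 s h
    · exact absurd (by simp [h]) hs
    · exact absurd (by simp [h]) hs
  rw [← intervalIntegral.integral_add_adjacent_intervals (hg.intervalIntegrable a y)
    (hg.intervalIntegrable y x), h1, add_zero]
  exact hle y hy

section Frame

variable {A : Type*} [NormedRing A] [NormedAlgebra ℝ A] [CompleteSpace A]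

open BoundedContinuousFunction in
/-- A linear Volterra equation in the plane with small kernels has a continuous solution. -/
theorem exists_continuous_volterra (m n : ℝ × ℝ → A) (hm : Continuous m) (hn : Continuous n)
    {t₀ x₀ C R : ℝ} (hR : 0 ≤ R) (hRC : 2 * (R * C) < 1)
    (hmC : ∀ p, ‖m p‖ ≤ C) (hnC : ∀ p, ‖n p‖ ≤ C)
    (hm0 : ∀ p, p ∉ closedBall (t₀, x₀) R → m p = 0)
    (hn0 : ∀ p, p ∉ closedBall (t₀, x₀) R → n p = 0) :
    ∃ V : ℝ × ℝ → A, Continuous V ∧ ∀ t x, V (t, x) =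
      1 + (∫ s in t₀..t, n (s, x₀) * V (s, x₀)) + ∫ s in x₀..x, m (t, s) * V (t, s) := by
  have hC0 : 0 ≤ C := (norm_nonneg _).trans (hmC (t₀, x₀))
  have hoff1 : ∀ s y, R < |s - t₀| → (s, y) ∉ closedBall (t₀, x₀) R := by
    intro s y hs h
    rw [mem_closedBall, Prod.dist_eq, max_le_iff] at h
    exact absurd h.1 (not_le.2 hs)
  have hoff2 : ∀ s y, R < |s - x₀| → (y, s) ∉ closedBall (t₀, x₀) R := by
    intro s y hs h
    rw [mem_closedBall, Prod.dist_eq, max_le_iff] at h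
    exact absurd h.2 (not_le.2 hs)
  -- The path of integration runs along the line `x = x₀` and then in the `x` direction. The kernels
  -- vanish off the ball of radius `R`, so each leg contributes at most `R * C * B`, which gives the
  -- contraction constant `2 * (R * C)`.
  let I : (ℝ × ℝ → A) → ℝ × ℝ → A := fun V p =>
    (∫ s in t₀..p.1, n (s, x₀) * V (s, x₀)) + ∫ s in x₀..p.2, m (p.1, s) * V (p.1, s)
  have hIcont : ∀ V, Continuous V → Continuous (I V) := by
    intro V hV
    refine Continuous.add ?_ ?_
    · exact intervalIntegral.continuous_parametric_intervalIntegral_of_continuous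
        (f := fun (p : ℝ × ℝ) s => n (s, x₀) * V (s, x₀)) (by fun_prop) continuous_fst
    · exact intervalIntegral.continuous_parametric_intervalIntegral_of_continuous
        (f := fun (p : ℝ × ℝ) s => m (p.1, s) * V (p.1, s)) (by fun_prop) continuous_snd
  have hIbound : ∀ V, Continuous V → ∀ B, (∀ p, ‖V p‖ ≤ B) → ∀ p, ‖I V p‖ ≤ 2 * (R * C) * B := by
    intro V hV B hB p
    have hb : ∀ (f : ℝ × ℝ → A), (∀ q, ‖f q‖ ≤ C) → ∀ q, ‖f q * V q‖ ≤ C * B := fun f hf q =>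
      (norm_mul_le _ _).trans (mul_le_mul (hf q) (hB q) (norm_nonneg _) hC0)
    have h1 := norm_intervalIntegral_le_of_eq_zero_off (g := fun s => n (s, x₀) * V (s, x₀))
      (by fun_prop) (a := t₀) hR (fun s => hb n hnC _)
      (fun s hs => by rw [hn0 _ (hoff1 s x₀ hs), zero_mul]) p.1
    have h2 := norm_intervalIntegral_le_of_eq_zero_off (g := fun s => m (p.1, s) * V (p.1, s))
      (by fun_prop) (a := x₀) hR (fun s => hb m hmC _)
      (fun s hs => by rw [hm0 _ (hoff2 s _ hs), zero_mul]) p.2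
    calc ‖I V p‖ ≤ _ := norm_add_le _ _
      _ ≤ C * B * R + C * B * R := add_le_add h1 h2
      _ = 2 * (R * C) * B := by ring
  have hIsub : ∀ V W, Continuous V → Continuous W → ∀ p, I (V - W) p = I V p - I W p := by
    intro V W hV hW p
    simp only [I, Pi.sub_apply, mul_sub]
    rw [intervalIntegral.integral_sub, intervalIntegral.integral_sub]
    · abel
    all_goals exact Continuous.intervalIntegrable (by fun_prop) _ _
  let T : ((ℝ × ℝ) →ᵇ A) → ((ℝ × ℝ) →ᵇ A) := fun V =>
    BoundedContinuousFunction.ofNormedAddCommGroup (fun p => 1 + I V p)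
      (continuous_const.add (hIcont V V.continuous)) (‖(1 : A)‖ + 2 * (R * C) * ‖V‖)
      (fun p => (norm_add_le _ _).trans (add_le_add_right
        (hIbound V V.continuous _ V.norm_coe_le_norm p) _))
  have hT : ContractingWith ⟨2 * (R * C), by positivity⟩ T := by
    refine ⟨by exact_mod_cast hRC, LipschitzWith.of_dist_le_mul fun V W => ?_⟩
    rw [dist_eq_norm, dist_eq_norm]
    refine (BoundedContinuousFunction.norm_le
      (mul_nonneg (NNReal.coe_nonneg _) (norm_nonneg _))).2 fun p => ?_
    have : (T V - T W) p = I (V - W : (ℝ × ℝ) →ᵇ A) p := by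
      rw [show (⇑(V - W) : ℝ × ℝ → A) = ⇑V - ⇑W from BoundedContinuousFunction.coe_sub _ _,
        hIsub V W V.continuous W.continuous]
      simp [T]
    rw [this]
    exact hIbound _ (V - W).continuous _ (V - W).norm_coe_le_norm p
  refine ⟨hT.fixedPoint, (hT.fixedPoint).continuous, fun t x => ?_⟩
  have := congrArg (fun f : (ℝ × ℝ) →ᵇ A => f (t, x)) hT.fixedPoint_isFixedPt.eq
  rw [add_assoc]
  exact this.symm

theorem hasDerivAt_intervalIntegral_of_continuous {E : Type*} [NormedAddCommGroup E]
    [NormedSpace ℝ E] {F F' : ℝ → ℝ → E} (hF : Continuous F.uncurry) (hF' : Continuous F'.uncurry)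
    (h : ∀ s x, HasDerivAt (fun y => F s y) (F' s x) x) (a b x : ℝ) :
    HasDerivAt (fun y => ∫ s in a..b, F s y) (∫ s in a..b, F' s x) x := by
  obtain ⟨B, hB⟩ := ((isCompact_uIcc (a := a) (b := b)).prod
    (isCompact_closedBall x 1)).exists_bound_of_continuousOn hF'.continuousOn
  refine (intervalIntegral.hasDerivAt_integral_of_dominated_loc_of_deriv_le
    (F := fun y s => F s y) (F' := fun y s => F' s y) (bound := fun _ => B) (s := closedBall x 1)
    (closedBall_mem_nhds x one_pos) ?_ ?_ ?_ ?_ ?_ ?_).2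
  · exact Eventually.of_forall fun y => Continuous.aestronglyMeasurable
      (hF.comp (by fun_prop : Continuous fun s : ℝ => (s, y)))
  · exact Continuous.intervalIntegrable (hF.comp (by fun_prop : Continuous fun s : ℝ => (s, x))) _ _
  · exact Continuous.aestronglyMeasurable
      (hF'.comp (by fun_prop : Continuous fun s : ℝ => (s, x)))
  · exact Eventually.of_forall fun s hs y hy => hB (s, y) ⟨uIoc_subset_uIcc hs, hy⟩
  · exact intervalIntegrable_const
  · exact Eventually.of_forall fun s hs y hy => h s y

/-- Local flat frames: a flat connection with small coefficients has a parallel section with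
prescribed value `1` at a point. -/
theorem exists_local_parallel_of_small (m n : ℝ × ℝ → A) (hm : ContDiff ℝ 1 m)
    (hn : ContDiff ℝ 1 n) {t₀ x₀ C R r : ℝ} (hR : 0 ≤ R) (hRC : 2 * (R * C) < 1)
    (hmC : ∀ p, ‖m p‖ ≤ C) (hnC : ∀ p, ‖n p‖ ≤ C)
    (hm0 : ∀ p, p ∉ closedBall (t₀, x₀) R → m p = 0)
    (hn0 : ∀ p, p ∉ closedBall (t₀, x₀) R → n p = 0) (hr : 0 < r)
    (hrC : (C + r * C) * r < 1)
    (hm' : ∀ p ∈ closedBall (t₀, x₀) r, ‖fderiv ℝ m p (1, 0)‖ ≤ C)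
    (hflat : ∀ p ∈ closedBall (t₀, x₀) r,
      fderiv ℝ m p (1, 0) + m p * n p = fderiv ℝ n p (0, 1) + n p * m p) :
    ∃ V : ℝ × ℝ → A, Continuous V ∧ V (t₀, x₀) = 1 ∧ ∀ t x, (t, x) ∈ ball (t₀, x₀) r →
      HasDerivAt (fun s => V (s, x)) (n (t, x) * V (t, x)) t ∧
      HasDerivAt (fun y => V (t, y)) (m (t, x) * V (t, x)) x := by
  obtain ⟨V, hV, hVeq⟩ := exists_continuous_volterra m n hm.continuous hn.continuous hR hRC
    hmC hnC hm0 hn0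
  have hC0 : 0 ≤ C := (norm_nonneg _).trans (hmC (t₀, x₀))
  have hmc := hm.continuous
  have hnc := hn.continuous
  have hmt : Continuous fun p => fderiv ℝ m p (1, 0) :=
    (hm.continuous_fderiv (by norm_num)).clm_apply continuous_const
  have hnx : Continuous fun p => fderiv ℝ n p (0, 1) :=
    (hn.continuous_fderiv (by norm_num)).clm_apply continuous_const
  have dm : ∀ t x, HasDerivAt (fun s => m (s, x)) (fderiv ℝ m (t, x) (1, 0)) t := fun t x =>
    ((hm.differentiable (by norm_num)) (t, x)).hasFDerivAt.comp_hasDerivAt t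
      ((hasDerivAt_id t).prodMk (hasDerivAt_const t x))
  have dn : ∀ t x, HasDerivAt (fun y => n (t, y)) (fderiv ℝ n (t, x) (0, 1)) x := fun t x =>
    ((hn.differentiable (by norm_num)) (t, x)).hasFDerivAt.comp_hasDerivAt x
      ((hasDerivAt_const x t).prodMk (hasDerivAt_id x))
  have dV : ∀ t x, HasDerivAt (fun y => V (t, y)) (m (t, x) * V (t, x)) x := by
    intro t x
    have h := (Continuous.integral_hasStrictDerivAt (f := fun s => m (t, s) * V (t, s))
      (by fun_prop) x₀ x).hasDerivAt.const_add (1 + ∫ s in t₀..t, n (s, x₀) * V (s, x₀))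
    exact h.congr_of_eventuallyEq (Eventually.of_forall fun y => hVeq t y)
  -- `V` solves the `x`-equation everywhere, but by construction the `t`-equation only for `x = x₀`.
  -- `Y` has the desired `t`-derivative `n V` and equals `V` at `t = t₀`, so it remains to show `Y =
  -- V` near the centre.
  let Y : ℝ → ℝ → A := fun t x => V (t₀, x) + ∫ s in t₀..t, n (s, x) * V (s, x)
  have hYcont : Continuous (Function.uncurry Y) := by
    refine Continuous.add (by fun_prop) ?_
    exact intervalIntegral.continuous_parametric_intervalIntegral_of_continuous
      (f := fun (p : ℝ × ℝ) s => n (s, p.2) * V (s, p.2)) (by fun_prop) continuous_fst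
  have dYt : ∀ t x, HasDerivAt (fun s => Y s x) (n (t, x) * V (t, x)) t := fun t x =>
    (Continuous.integral_hasStrictDerivAt (f := fun s => n (s, x) * V (s, x))
      (by fun_prop) t₀ t).hasDerivAt.const_add _
  have dYx : ∀ t x, HasDerivAt (fun y => Y t y) (m (t₀, x) * V (t₀, x) +
      ∫ s in t₀..t, (fderiv ℝ n (s, x) (0, 1) * V (s, x) + n (s, x) * (m (s, x) * V (s, x)))) x := by
    intro t x
    refine (dV t₀ x).add (hasDerivAt_intervalIntegral_of_continuous
      (F := fun s x => n (s, x) * V (s, x))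
      (F' := fun s x => fderiv ℝ n (s, x) (0, 1) * V (s, x) + n (s, x) * (m (s, x) * V (s, x)))
      ?_ ?_ (fun s x => (dn s x).mul (dV s x)) t₀ t x)
    · change Continuous fun p : ℝ × ℝ => n (p.1, p.2) * V (p.1, p.2)
      fun_prop
    · change Continuous fun p : ℝ × ℝ => fderiv ℝ n p (0, 1) * V p + n p * (m p * V p)
      fun_prop
  have hball : ∀ t x, (t, x) ∈ closedBall (t₀, x₀) r ↔ |t - t₀| ≤ r ∧ |x - x₀| ≤ r := by
    intro t x
    rw [mem_closedBall, Prod.dist_eq, max_le_iff]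
    rfl
  let D : ℝ × ℝ → A := fun p => Y p.1 p.2 - V p
  have hDcont : Continuous D := hYcont.sub hV
  -- Flatness exchanges `n_x + n m` for `m_t + m n`, and integrating `(m Y)_t` leaves a homogeneous
  -- linear equation for the defect `D`.
  have dD : ∀ t x, (t, x) ∈ closedBall (t₀, x₀) r → HasDerivAt (fun y => D (t, y))
      (m (t, x) * D (t, x) - ∫ s in t₀..t, fderiv ℝ m (s, x) (1, 0) * D (s, x)) x := by
    intro t x htx
    refine ((dYx t x).sub (dV t x)).congr_deriv ?_
    have e1 : ∫ s in t₀..t, (fderiv ℝ n (s, x) (0, 1) * V (s, x) + n (s, x) * (m (s, x) * V (s, x)))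
        = ∫ s in t₀..t, (fderiv ℝ m (s, x) (1, 0) * V (s, x) + m (s, x) * (n (s, x) * V (s, x))) := by
      refine intervalIntegral.integral_congr fun s hs => ?_
      have hs' : (s, x) ∈ closedBall (t₀, x₀) r := by
        rw [hball] at htx ⊢
        exact ⟨(abs_sub_left_of_mem_uIcc hs).trans htx.1, htx.2⟩
      have := hflat _ hs'
      simp only [← mul_assoc, ← add_mul, this]
    have e2 : (∫ s in t₀..t, (fderiv ℝ m (s, x) (1, 0) * Y s x + m (s, x) * (n (s, x) * V (s, x))))
        = m (t, x) * Y t x - m (t₀, x) * Y t₀ x := by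
      refine intervalIntegral.integral_eq_sub_of_hasDerivAt
        (fun s _ => (dm s x).mul (dYt s x)) (Continuous.intervalIntegrable ?_ _ _)
      have : Continuous fun s => Y s x := hYcont.comp (by fun_prop : Continuous fun s : ℝ => (s, x))
      fun_prop
    have e3 : Y t₀ x = V (t₀, x) := by simp [Y]
    have e4 : ∫ s in t₀..t, fderiv ℝ m (s, x) (1, 0) * D (s, x) =
        (∫ s in t₀..t, (fderiv ℝ m (s, x) (1, 0) * Y s x + m (s, x) * (n (s, x) * V (s, x)))) -
        ∫ s in t₀..t, (fderiv ℝ m (s, x) (1, 0) * V (s, x) + m (s, x) * (n (s, x) * V (s, x))) := by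
      have : Continuous fun s => Y s x := hYcont.comp (by fun_prop : Continuous fun s : ℝ => (s, x))
      rw [← intervalIntegral.integral_sub]
      · refine intervalIntegral.integral_congr fun s _ => ?_
        simp only [D, mul_sub]
        abel
      all_goals exact Continuous.intervalIntegrable (by fun_prop) _ _
    rw [e1, e4, e2, e3]
    simp only [D, mul_sub]
    abel
  have hD0 : ∀ t, D (t, x₀) = 0 := by
    intro t
    simp only [D, Y, hVeq t x₀, hVeq t₀ x₀]
    simp
  have hcb : IsCompact (closedBall (t₀, x₀) r) := isCompact_closedBall _ _
  -- Since `D` vanishes on `x = x₀`, the mean value inequality at a maximum point of `‖D‖` bounds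
  -- the maximum by `(C + r * C) * r < 1` times itself, so it is zero.
  obtain ⟨⟨t₁, x₁⟩, h1, hmax⟩ := hcb.exists_isMaxOn (nonempty_closedBall.2 hr.le)
    hDcont.norm.continuousOn
  have hmax' : ∀ p ∈ closedBall (t₀, x₀) r, ‖D p‖ ≤ ‖D (t₁, x₁)‖ := fun p hp => hmax hp
  have h1' := (hball _ _).1 h1
  have hbound : ‖D (t₁, x₁) - D (t₁, x₀)‖ ≤ ((C + r * C) * ‖D (t₁, x₁)‖) * ‖x₁ - x₀‖ := by
    refine (convex_uIcc x₀ x₁).norm_image_sub_le_of_norm_hasDerivWithin_le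
      (f := fun y => D (t₁, y)) (fun y hy => (dD t₁ y ?_).hasDerivWithinAt) (fun y hy => ?_)
      left_mem_uIcc right_mem_uIcc
    · rw [hball]
      exact ⟨h1'.1, (abs_sub_left_of_mem_uIcc hy).trans h1'.2⟩
    · have hy' : |y - x₀| ≤ r := (abs_sub_left_of_mem_uIcc hy).trans h1'.2
      have b1 : ‖m (t₁, y) * D (t₁, y)‖ ≤ C * ‖D (t₁, x₁)‖ := (norm_mul_le _ _).trans
        (mul_le_mul (hmC _) (hmax' _ ((hball _ _).2 ⟨h1'.1, hy'⟩)) (norm_nonneg _) hC0)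
      have b2 : ‖∫ s in t₀..t₁, fderiv ℝ m (s, y) (1, 0) * D (s, y)‖ ≤
          (C * ‖D (t₁, x₁)‖) * |t₁ - t₀| := by
        refine intervalIntegral.norm_integral_le_of_norm_le_const fun s hs => ?_
        have hs' : (s, y) ∈ closedBall (t₀, x₀) r := (hball _ _).2
          ⟨(abs_sub_left_of_mem_uIcc (uIoc_subset_uIcc hs)).trans h1'.1, hy'⟩
        exact (norm_mul_le _ _).trans (mul_le_mul (hm' _ hs') (hmax' _ hs') (norm_nonneg _) hC0)
      have b3 : (C * ‖D (t₁, x₁)‖) * |t₁ - t₀| ≤ (C * ‖D (t₁, x₁)‖) * r :=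
        mul_le_mul_of_nonneg_left h1'.1 (by positivity)
      calc _ ≤ _ := norm_sub_le _ _
        _ ≤ C * ‖D (t₁, x₁)‖ + (C * ‖D (t₁, x₁)‖) * r := add_le_add b1 (b2.trans b3)
        _ = _ := by ring
  have hDmax : ‖D (t₁, x₁)‖ = 0 := by
    rw [hD0, sub_zero] at hbound
    have b : ‖D (t₁, x₁)‖ ≤ ((C + r * C) * ‖D (t₁, x₁)‖) * r :=
      hbound.trans (mul_le_mul_of_nonneg_left h1'.2 (by positivity))
    by_contra hne
    have hpos : 0 < ‖D (t₁, x₁)‖ := lt_of_le_of_ne (norm_nonneg _) (Ne.symm hne)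
    have : (C + r * C) * r * ‖D (t₁, x₁)‖ < 1 * ‖D (t₁, x₁)‖ := mul_lt_mul_of_pos_right hrC hpos
    linarith
  have hYV : ∀ p ∈ closedBall (t₀, x₀) r, Y p.1 p.2 = V p := fun p hp => by
    have := (hmax' p hp).trans hDmax.le
    exact sub_eq_zero.1 (norm_le_zero_iff.1 this)
  refine ⟨V, hV, by simp [hVeq t₀ x₀], fun t x htx => ⟨?_, dV t x⟩⟩
  refine (dYt t x).congr_of_eventuallyEq ?_
  have hc : ContinuousAt (fun s : ℝ => (s, x)) t := by fun_prop
  filter_upwards [hc.preimage_mem_nhds (isOpen_ball.mem_nhds htx)] with s hs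
  exact (hYV (s, x) (ball_subset_closedBall hs)).symm

end Frame

/-! ### Parallel frames of a flat connection -/

section GlobalFrame

variable {A : Type*} [NormedRing A] [NormedAlgebra ℝ A]

/-- The derivative at `p` of a function `Φ` with `Φ_t = N Φ` and `Φ_x = M Φ`. -/
noncomputable def parallelDeriv (M N Φ : ℝ × ℝ → A) (p : ℝ × ℝ) : ℝ × ℝ →L[ℝ] A :=
  (ContinuousLinearMap.toSpanSingleton ℝ (N p * Φ p)).coprod
    (ContinuousLinearMap.toSpanSingleton ℝ (M p * Φ p))

theorem parallelDeriv_apply (M N Φ : ℝ × ℝ → A) (p h : ℝ × ℝ) :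
    parallelDeriv M N Φ p h = h.1 • (N p * Φ p) + h.2 • (M p * Φ p) := by
  simp [parallelDeriv]

variable [CompleteSpace A]

/-- A cutoff makes the coefficients global and compactly supported without changing them near `p₀`,
and shrinking the support makes `R * C` small. The value `1` at `p₀` keeps the frame invertible
nearby. -/
theorem exists_local_parallel {Ω : Set (ℝ × ℝ)} (hΩ : IsOpen Ω) (M N : ℝ × ℝ → A)
    (hM : ContDiffOn ℝ 1 M Ω) (hN : ContDiffOn ℝ 1 N Ω)
    (hflat : ∀ p ∈ Ω, fderiv ℝ M p (1, 0) + M p * N p = fderiv ℝ N p (0, 1) + N p * M p)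
    {p₀ : ℝ × ℝ} (hp₀ : p₀ ∈ Ω) :
    ∃ r > 0, ball p₀ r ⊆ Ω ∧ ∃ Φ : ℝ × ℝ → A, ∀ p ∈ ball p₀ r,
      IsUnit (Φ p) ∧ HasFDerivAt Φ (parallelDeriv M N Φ p) p := by
  obtain ⟨t₀, x₀⟩ := p₀
  have hΩn := hΩ.mem_nhds hp₀
  have cM : ContinuousAt M (t₀, x₀) := hM.continuousOn.continuousAt hΩn
  have cN : ContinuousAt N (t₀, x₀) := hN.continuousOn.continuousAt hΩn
  have cM' : ContinuousAt (fun p => fderiv ℝ M p (1, 0)) (t₀, x₀) :=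
    ((hM.continuousOn_fderiv_of_isOpen hΩ le_rfl).clm_apply continuousOn_const).continuousAt hΩn
  obtain ⟨C, hC1, hCM, hCN, hCM'⟩ : ∃ C : ℝ, 1 ≤ C ∧ ‖M (t₀, x₀)‖ < C ∧ ‖N (t₀, x₀)‖ < C ∧
      ‖fderiv ℝ M (t₀, x₀) (1, 0)‖ < C :=
    ⟨1 + ‖M (t₀, x₀)‖ + ‖N (t₀, x₀)‖ + ‖fderiv ℝ M (t₀, x₀) (1, 0)‖, by
      have := norm_nonneg (M (t₀, x₀)); have := norm_nonneg (N (t₀, x₀))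
      have := norm_nonneg (fderiv ℝ M (t₀, x₀) (1, 0))
      refine ⟨?_, ?_, ?_, ?_⟩ <;> linarith⟩
  obtain ⟨δ, hδ, hδs⟩ := Metric.eventually_nhds_iff_ball.1
    ((hΩ.eventually_mem hp₀).and ((cM.norm.eventually_lt_const hCM).and
      ((cN.norm.eventually_lt_const hCN).and (cM'.norm.eventually_lt_const hCM'))))
  -- As `C ≥ 1`, the bound `4 * (R * C) ≤ 1` yields both smallness conditions, the second with `r =
  -- R / 4`.
  obtain ⟨R, hR, hRδ, hRC⟩ : ∃ R : ℝ, 0 < R ∧ R < δ ∧ 4 * (R * C) ≤ 1 := by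
    have hCpos : 0 < C := by linarith
    refine ⟨min (δ / 2) (1 / (4 * C)), by positivity, (min_le_left _ _).trans_lt (by linarith), ?_⟩
    calc 4 * (min (δ / 2) (1 / (4 * C)) * C) ≤ 4 * (1 / (4 * C) * C) := by gcongr; exact min_le_right _ _
      _ = 1 := by field_simp
  have hR1 : R ≤ 1 / 4 := by nlinarith
  -- The cutoff is `1` on the ball of radius `R / 2`, so on the closed ball of radius `R / 4` the
  -- derivatives of the coefficients are unchanged as well.
  let χ : ContDiffBump ((t₀, x₀) : ℝ × ℝ) := ⟨R / 2, R, by positivity, by linarith⟩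
  have hts : tsupport χ ⊆ ball (t₀, x₀) δ := by
    rw [χ.tsupport_eq]; exact closedBall_subset_ball hRδ
  have hsm : ∀ F : ℝ × ℝ → A, ContDiffOn ℝ 1 F Ω → ContDiff ℝ 1 fun p => χ p • F p := by
    intro F hF
    refine contDiff_iff_contDiffAt.2 fun p => ?_
    by_cases hp : p ∈ tsupport χ
    · exact χ.contDiff.contDiffAt.smul (hF.contDiffAt (hΩ.mem_nhds (hδs p (hts hp)).1))
    · refine (contDiffAt_const (c := 0)).congr_of_eventuallyEq ?_
      filter_upwards [notMem_tsupport_iff_eventuallyEq.1 hp] with q hq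
      simp [hq]
  have h0 : ∀ F : ℝ × ℝ → A, ∀ p, p ∉ closedBall (t₀, x₀) R → χ p • F p = 0 := by
    intro F p hp
    have : χ p = 0 := χ.zero_of_le_dist (le_of_lt (by simpa [mem_closedBall] using hp))
    rw [this, zero_smul]
  have hbd : ∀ F : ℝ × ℝ → A, (∀ p ∈ ball (t₀, x₀) δ, ‖F p‖ < C) → ∀ p, ‖χ p • F p‖ ≤ C := by
    intro F hF p
    by_cases hp : p ∈ closedBall (t₀, x₀) R
    · rw [norm_smul, Real.norm_of_nonneg χ.nonneg]
      have := (hF p (closedBall_subset_ball hRδ hp)).le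
      calc χ p * ‖F p‖ ≤ 1 * C := mul_le_mul χ.le_one this (norm_nonneg _) zero_le_one
        _ = C := one_mul _
    · rw [h0 F p hp, norm_zero]; linarith
  have heq : ∀ F : ℝ × ℝ → A, ∀ p ∈ closedBall (t₀, x₀) (R / 4),
      (fun q => χ q • F q) =ᶠ[𝓝 p] F := by
    intro F p hp
    have : p ∈ ball (t₀, x₀) (R / 2) := closedBall_subset_ball (by linarith) hp
    filter_upwards [isOpen_ball.mem_nhds this] with q hq
    rw [χ.one_of_mem_closedBall (ball_subset_closedBall hq), one_smul]
  have hin : ∀ p ∈ closedBall (t₀, x₀) (R / 4), p ∈ ball (t₀, x₀) δ := fun p hp =>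
    closedBall_subset_ball (by linarith) hp
  obtain ⟨V, hV, hV1, hVd⟩ := exists_local_parallel_of_small (fun p => χ p • M p)
    (fun p => χ p • N p) (hsm M hM) (hsm N hN) (t₀ := t₀) (x₀ := x₀) (C := C) (R := R) (r := R / 4)
    hR.le (by linarith) (hbd M fun p hp => (hδs p hp).2.1) (hbd N fun p hp => (hδs p hp).2.2.1)
    (h0 M) (h0 N) (by positivity) (by nlinarith)
    (fun p hp => by
      rw [(heq M p hp).fderiv_eq]
      exact (hδs p (hin p hp)).2.2.2.le)
    (fun p hp => by
      rw [(heq M p hp).fderiv_eq, (heq N p hp).fderiv_eq, (heq M p hp).eq_of_nhds,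
        (heq N p hp).eq_of_nhds]
      exact hflat p (hδs p (hin p hp)).1)
  have hunit : ∀ᶠ p in 𝓝 (t₀, x₀), IsUnit (V p) := by
    have : V (t₀, x₀) ∈ {a : A | IsUnit a} := by rw [hV1]; exact isUnit_one
    exact hV.continuousAt.eventually (Units.isOpen.mem_nhds this)
  obtain ⟨ε, hε, hεu⟩ := Metric.eventually_nhds_iff_ball.1 hunit
  have hsub : ball (t₀, x₀) (min ε (R / 4)) ⊆ closedBall (t₀, x₀) (R / 4) :=
    (ball_subset_ball (min_le_right _ _)).trans ball_subset_closedBall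
  refine ⟨min ε (R / 4), by positivity, fun p hp => (hδs p (hin p (hsub hp))).1, V, fun p hp =>
    ⟨hεu p (ball_subset_ball (min_le_left _ _) hp), ?_⟩⟩
  have hnear : ∀ᶠ q in 𝓝 p, q ∈ ball (t₀, x₀) (R / 4) :=
    isOpen_ball.mem_nhds (ball_subset_ball (min_le_right _ _) hp)
  have hval : ∀ F : ℝ × ℝ → A, ∀ q ∈ ball (t₀, x₀) (R / 4), χ q • F q = F q := fun F q hq =>
    (heq F q (ball_subset_closedBall hq)).eq_of_nhds
  have hpΩ := hΩ.mem_nhds (hδs p (hin p (hsub hp))).1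
  have hspan : Continuous fun a : A => ContinuousLinearMap.toSpanSingleton ℝ a :=
    (ContinuousLinearMap.toSpanSingletonLIE ℝ A).continuous
  have cNV : ContinuousAt (fun q : ℝ × ℝ => ContinuousLinearMap.toSpanSingleton ℝ (N q * V q)) p :=
    ContinuousAt.comp (f := fun q => N q * V q) hspan.continuousAt ((hN.continuousOn.continuousAt hpΩ).mul hV.continuousAt)
  have cMV : ContinuousAt (fun q : ℝ × ℝ => ContinuousLinearMap.toSpanSingleton ℝ (M q * V q)) p :=
    ContinuousAt.comp (f := fun q => M q * V q) hspan.continuousAt ((hM.continuousOn.continuousAt hpΩ).mul hV.continuousAt)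
  -- Partial derivatives that exist near `p` and are continuous at `p` give total differentiability.
  refine (hasStrictFDerivAt_uncurry_coprod (f := fun t x : ℝ => V (t, x))
    (f₁ := fun t x : ℝ => ContinuousLinearMap.toSpanSingleton ℝ (N (t, x) * V (t, x)))
    (f₂ := fun t x : ℝ => ContinuousLinearMap.toSpanSingleton ℝ (M (t, x) * V (t, x)))
    ?_ ?_ cNV cMV).hasFDerivAt
  · filter_upwards [hnear] with q hq
    have := (hVd q.1 q.2 hq).1
    simp only [hval N q hq] at this
    exact this.hasFDerivAt
  · filter_upwards [hnear] with q hq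
    have := (hVd q.1 q.2 hq).2
    simp only [hval M q hq] at this
    exact this.hasFDerivAt

/-- The quotient of two parallel frames is locally constant. -/
theorem eventually_inv_mul_eq {M N Φ Ψ : ℝ × ℝ → A} {U : Set (ℝ × ℝ)} (hU : IsOpen U)
    (g h : ℝ × ℝ → Aˣ) (hg : ∀ p ∈ U, (g p : A) = Φ p) (hh : ∀ p ∈ U, (h p : A) = Ψ p)
    (hΦ : ∀ p ∈ U, HasFDerivAt Φ (parallelDeriv M N Φ p) p)
    (hΨ : ∀ p ∈ U, HasFDerivAt Ψ (parallelDeriv M N Ψ p) p) {p : ℝ × ℝ} (hp : p ∈ U) :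
    ∀ᶠ q in 𝓝 p, (h q)⁻¹ * g q = (h p)⁻¹ * g p := by
  obtain ⟨r, hr, hrU⟩ := Metric.isOpen_iff.1 hU p hp
  -- `M` and `N` act on both frames from the left, so in the derivative of `Ψ⁻¹ Φ` the term from
  -- `Ψ⁻¹` cancels the term from `Φ`.
  have hd : ∀ q ∈ ball p r, HasFDerivAt (fun q => Ring.inverse (Ψ q) * Φ q)
      (0 : ℝ × ℝ →L[ℝ] A) q := by
    intro q hq
    have h1 := (hasFDerivAt_ringInverse (𝕜 := ℝ) (h q))
    rw [hh q (hrU hq)] at h1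
    refine ((h1.comp q (hΨ q (hrU hq))).mul' (hΦ q (hrU hq))).congr_fderiv ?_
    have e1 : Ring.inverse (Ψ q) = ((h q)⁻¹ : Aˣ) := by
      rw [← hh q (hrU hq), Ring.inverse_unit]
    have e2 : ∀ a, Ψ q * (((h q)⁻¹ : Aˣ) * a) = a := fun a => by
      rw [← hh q (hrU hq), Units.mul_inv_cancel_left]
    ext <;> simp [parallelDeriv, e1, mul_assoc, e2]
  have hconst : ∀ q ∈ ball p r, Ring.inverse (Ψ q) * Φ q = Ring.inverse (Ψ p) * Φ p := fun q hq =>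
    (convex_ball p r).is_const_of_fderivWithin_eq_zero (𝕜 := ℝ)
      (fun y hy => (hd y hy).differentiableAt.differentiableWithinAt)
      (fun y hy => by rw [fderivWithin_of_isOpen isOpen_ball hy, (hd y hy).fderiv]) hq
      (mem_ball_self hr)
  filter_upwards [isOpen_ball.mem_nhds (mem_ball_self hr)] with q hq
  have := hconst q hq
  rw [← hg q (hrU hq), ← hh q (hrU hq), ← hg p hp, ← hh p hp, Ring.inverse_unit,
    Ring.inverse_unit] at this
  exact_mod_cast this

/-- A flat connection over a simply connected open set of the plane has a global parallel frame. -/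
theorem exists_global_parallel {Ω : Set (ℝ × ℝ)} (hΩ : IsOpen Ω) (hΩ' : IsSimplyConnected Ω)
    (M N : ℝ × ℝ → A) (hM : ContDiffOn ℝ ∞ M Ω) (hN : ContDiffOn ℝ ∞ N Ω)
    (hflat : ∀ p ∈ Ω, fderiv ℝ M p (1, 0) + M p * N p = fderiv ℝ N p (0, 1) + N p * M p) :
    ∃ Φ : ℝ × ℝ → A, ContDiffOn ℝ ∞ Φ Ω ∧ ∀ p ∈ Ω,
      IsUnit (Φ p) ∧ HasFDerivAt Φ (parallelDeriv M N Φ p) p := by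
  classical
  have _ : SimplyConnectedSpace Ω := hΩ'
  have _ := hΩ.locallyPathConnectedSpace
  have loc := fun p : Ω => exists_local_parallel hΩ M N (hM.of_le (by exact_mod_cast le_top))
    (hN.of_le (by exact_mod_cast le_top)) hflat p.2
  choose r hr hrΩ Φ hΦ using loc
  let g : Ω → ℝ × ℝ → Aˣ := fun i p => if h : IsUnit (Φ i p) then h.unit else 1
  have hg : ∀ i, ∀ p ∈ ball i.1 (r i), (g i p : A) = Φ i p := by
    intro i p hp
    simp [g, (hΦ i p hp).1]
  obtain ⟨s, hs⟩ := exists_section_of_locallyConstant_quotients (X := Ω) (G := Aˣ) (ι := Ω)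
    (fun i => Subtype.val ⁻¹' ball i.1 (r i)) (fun i => isOpen_ball.preimage continuous_subtype_val)
    (fun x => ⟨x, mem_ball_self (hr x)⟩) (fun i x => g i x) (by
      intro i j x hx
      exact continuous_subtype_val.continuousAt.eventually
        (eventually_inv_mul_eq (U := ball i.1 (r i) ∩ ball j.1 (r j)) (M := M) (N := N)
        (isOpen_ball.inter isOpen_ball) (g i) (g j)
        (fun p hp => hg i p hp.1) (fun p hp => hg j p hp.2) (fun p hp => (hΦ i p hp.1).2)
        (fun p hp => (hΦ j p hp.2).2) hx))
  let Ψ : ℝ × ℝ → A := fun p => if h : p ∈ Ω then (s ⟨p, h⟩ : A) else 0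
  have hΨ : ∀ p ∈ Ω, IsUnit (Ψ p) ∧ HasFDerivAt Ψ (parallelDeriv M N Ψ p) p := by
    intro p hp
    refine ⟨by simp [Ψ, hp], ?_⟩
    have h1 := hs ⟨p, hp⟩ ⟨p, hp⟩ (mem_ball_self (hr _))
    rw [nhds_subtype_eq_comap, eventually_comap] at h1
    -- Near `p` the glued frame is a local frame times a constant on the right, and such a factor
    -- commutes with the left action of `M` and `N`.
    have h2 : Ψ =ᶠ[𝓝 p] fun q => Φ ⟨p, hp⟩ q *
        (((g ⟨p, hp⟩ p)⁻¹ * s ⟨p, hp⟩ : Aˣ) : A) := by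
      filter_upwards [h1, hΩ.mem_nhds hp, isOpen_ball.mem_nhds (mem_ball_self (hr ⟨p, hp⟩))]
        with q hq hqΩ hqr
      have := hq ⟨q, hqΩ⟩ rfl
      rw [← hg _ q hqr, ← Units.val_mul, ← this]
      simp [Ψ, hqΩ]
    have h3 := ((hΦ ⟨p, hp⟩ p (mem_ball_self (hr _))).2.mul_const'
      (((g ⟨p, hp⟩ p)⁻¹ * s ⟨p, hp⟩ : Aˣ) : A)).congr_of_eventuallyEq h2
    refine h3.congr_fderiv ?_
    ext <;> simp [parallelDeriv, h2.eq_of_nhds, mul_assoc]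
  refine ⟨Ψ, ?_, hΨ⟩
  -- Bootstrap: the derivative of `Ψ` is built from `N Ψ` and `M Ψ`, so it is as smooth as `Ψ`
  -- itself.
  rw [contDiffOn_infty]
  intro n
  induction n with
  | zero =>
    exact contDiffOn_zero.2 fun p hp => (hΨ p hp).2.continuousAt.continuousWithinAt
  | succ n ih =>
    rw [show ((n + 1 : ℕ) : WithTop ℕ∞) = (n : WithTop ℕ∞) + 1 by norm_cast,
      contDiffOn_succ_iff_fderiv_of_isOpen hΩ]
    refine ⟨fun p hp => (hΨ p hp).2.differentiableAt.differentiableWithinAt, by simp, ?_⟩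
    have hMn : ContDiffOn ℝ n M Ω := hM.of_le (by exact_mod_cast le_top)
    have hNn : ContDiffOn ℝ n N Ω := hN.of_le (by exact_mod_cast le_top)
    refine ContDiffOn.congr (f := fun p =>
      (ContinuousLinearMap.fst ℝ ℝ ℝ).smulRight (N p * Ψ p) +
      (ContinuousLinearMap.snd ℝ ℝ ℝ).smulRight (M p * Ψ p)) ?_ fun p hp => ?_
    · exact (contDiffOn_const.smulRight (hNn.mul ih)).add (contDiffOn_const.smulRight (hMn.mul ih))
    · rw [(hΨ p hp).2.fderiv]
      ext <;> simp [parallelDeriv]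

end GlobalFrame

namespace Burgers

/-! ### Calculus of the partial derivatives and of determinants -/

section Calculus

variable {f g : ℝ × ℝ → ℝ} {p : ℝ × ℝ} {Ω : Set (ℝ × ℝ)}

theorem dx_add (hf : DifferentiableAt ℝ f p) (hg : DifferentiableAt ℝ g p) :
    dx (fun q => f q + g q) p = dx f p + dx g p := by
  simp [dx, fderiv_fun_add hf hg]

theorem dt_add (hf : DifferentiableAt ℝ f p) (hg : DifferentiableAt ℝ g p) :
    dt (fun q => f q + g q) p = dt f p + dt g p := by
  simp [dt, fderiv_fun_add hf hg]

theorem dx_sub (hf : DifferentiableAt ℝ f p) (hg : DifferentiableAt ℝ g p) :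
    dx (fun q => f q - g q) p = dx f p - dx g p := by
  simp [dx, fderiv_fun_sub hf hg]

theorem dt_sub (hf : DifferentiableAt ℝ f p) (hg : DifferentiableAt ℝ g p) :
    dt (fun q => f q - g q) p = dt f p - dt g p := by
  simp [dt, fderiv_fun_sub hf hg]

theorem dx_mul (hf : DifferentiableAt ℝ f p) (hg : DifferentiableAt ℝ g p) :
    dx (fun q => f q * g q) p = dx f p * g p + f p * dx g p := by
  simp [dx, fderiv_fun_mul hf hg]; ring

theorem dt_mul (hf : DifferentiableAt ℝ f p) (hg : DifferentiableAt ℝ g p) :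
    dt (fun q => f q * g q) p = dt f p * g p + f p * dt g p := by
  simp [dt, fderiv_fun_mul hf hg]; ring

theorem dx_neg : dx (fun q => -f q) p = -dx f p := by simp [dx]

theorem dt_neg : dt (fun q => -f q) p = -dt f p := by simp [dt]

theorem dx_const (k : ℝ) : dx (fun _ => k) p = 0 := by simp [dx]

theorem dt_const (k : ℝ) : dt (fun _ => k) p = 0 := by simp [dt]

theorem dx_sum {ι : Type*} {s : Finset ι} {f : ι → ℝ × ℝ → ℝ}
    (hf : ∀ i ∈ s, DifferentiableAt ℝ (f i) p) :
    dx (fun q => ∑ i ∈ s, f i q) p = ∑ i ∈ s, dx (f i) p := by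
  simp [dx, fderiv_fun_sum hf]

theorem dt_sum {ι : Type*} {s : Finset ι} {f : ι → ℝ × ℝ → ℝ}
    (hf : ∀ i ∈ s, DifferentiableAt ℝ (f i) p) :
    dt (fun q => ∑ i ∈ s, f i q) p = ∑ i ∈ s, dt (f i) p := by
  simp [dt, fderiv_fun_sum hf]

theorem dx_sum_mul {ι : Type*} [Fintype ι] {f g : ι → ℝ × ℝ → ℝ}
    (hf : ∀ i, DifferentiableAt ℝ (f i) p) (hg : ∀ i, DifferentiableAt ℝ (g i) p) :
    dx (fun q => ∑ i, f i q * g i q) p = ∑ i, (dx (f i) p * g i p + f i p * dx (g i) p) := by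
  rw [dx_sum fun i _ => (hf i).fun_mul (hg i)]
  exact Finset.sum_congr rfl fun i _ => dx_mul (hf i) (hg i)

theorem dt_sum_mul {ι : Type*} [Fintype ι] {f g : ι → ℝ × ℝ → ℝ}
    (hf : ∀ i, DifferentiableAt ℝ (f i) p) (hg : ∀ i, DifferentiableAt ℝ (g i) p) :
    dt (fun q => ∑ i, f i q * g i q) p = ∑ i, (dt (f i) p * g i p + f i p * dt (g i) p) := by
  rw [dt_sum fun i _ => (hf i).fun_mul (hg i)]
  exact Finset.sum_congr rfl fun i _ => dt_mul (hf i) (hg i)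

theorem dx_congr (hΩ : IsOpen Ω) (h : EqOn f g Ω) (hp : p ∈ Ω) : dx f p = dx g p := by
  rw [dx, dx, (h.eventuallyEq_of_mem (hΩ.mem_nhds hp)).fderiv_eq]

theorem dt_congr (hΩ : IsOpen Ω) (h : EqOn f g Ω) (hp : p ∈ Ω) : dt f p = dt g p := by
  rw [dt, dt, (h.eventuallyEq_of_mem (hΩ.mem_nhds hp)).fderiv_eq]

theorem contDiffOn_dx (hΩ : IsOpen Ω) (hf : ContDiffOn ℝ ∞ f Ω) : ContDiffOn ℝ ∞ (dx f) Ω :=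
  (hf.fderiv_of_isOpen hΩ le_rfl).clm_apply contDiffOn_const

theorem contDiffOn_iterate_dx (hΩ : IsOpen Ω) (hf : ContDiffOn ℝ ∞ f Ω) (k : ℕ) :
    ContDiffOn ℝ ∞ (dx^[k] f) Ω := by
  induction k with
  | zero => exact hf
  | succ k ih => rw [Function.iterate_succ_apply']; exact contDiffOn_dx hΩ ih

theorem differentiableAt_of_contDiffOn (hΩ : IsOpen Ω) (hf : ContDiffOn ℝ ∞ f Ω) (hp : p ∈ Ω) :
    DifferentiableAt ℝ f p :=
  (hf.contDiffAt (hΩ.mem_nhds hp)).differentiableAt (by simp)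

theorem dt_dx_comm (hΩ : IsOpen Ω) (hf : ContDiffOn ℝ ∞ f Ω) (hp : p ∈ Ω) :
    dt (dx f) p = dx (dt f) p := by
  have hd : DifferentiableAt ℝ (fderiv ℝ f) p :=
    ((hf.fderiv_of_isOpen hΩ (m := ∞) le_rfl).contDiffAt (hΩ.mem_nhds hp)).differentiableAt
      (by simp)
  have hs : IsSymmSndFDerivAt ℝ f p :=
    (hf.contDiffAt (hΩ.mem_nhds hp)).isSymmSndFDerivAt (by
      simpa using WithTop.coe_le_coe.2 (le_top : (2 : ℕ∞) ≤ ⊤))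
  have h : ∀ e e' : ℝ × ℝ, fderiv ℝ (fun q => fderiv ℝ f q e) p e' =
      fderiv ℝ (fderiv ℝ f) p e' e := fun e e' => by
    rw [fderiv_clm_apply hd (differentiableAt_const e)]
    simp
  change fderiv ℝ (fun q => fderiv ℝ f q (0, 1)) p (1, 0) =
    fderiv ℝ (fun q => fderiv ℝ f q (1, 0)) p (0, 1)
  rw [h, h]
  exact hs.eq _ _

theorem fderiv_eq_zero_of_dt_dx (ht : dt f p = 0) (hx : dx f p = 0) : fderiv ℝ f p = 0 := by
  ext
  · simpa [dt] using ht
  · simpa [dx] using hx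

theorem eq_of_dt_dx_eq_zero {U : Set (ℝ × ℝ)} (hU : IsOpen U) (hc : IsPreconnected U)
    (hf : ∀ p ∈ U, DifferentiableAt ℝ f p) (ht : ∀ p ∈ U, dt f p = 0) (hx : ∀ p ∈ U, dx f p = 0)
    {p q : ℝ × ℝ} (hp : p ∈ U) (hq : q ∈ U) : f p = f q :=
  hU.is_const_of_fderiv_eq_zero hc (fun p hp => (hf p hp).differentiableWithinAt)
    (fun p hp => fderiv_eq_zero_of_dt_dx (ht p hp) (hx p hp)) hp hq

end Calculus

theorem det3_eq (a b c : Fin 3 → ℝ) : det3 a b c =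
    a 0 * (b 1 * c 2 - b 2 * c 1) - a 1 * (b 0 * c 2 - b 2 * c 0)
      + a 2 * (b 0 * c 1 - b 1 * c 0) := by
  simp [det3, Matrix.det_fin_three]
  ring

theorem dx_det3 {a b c : Fin 3 → ℝ × ℝ → ℝ} {p : ℝ × ℝ} (ha : ∀ i, DifferentiableAt ℝ (a i) p)
    (hb : ∀ i, DifferentiableAt ℝ (b i) p) (hc : ∀ i, DifferentiableAt ℝ (c i) p) :
    dx (fun q => det3 (fun i => a i q) (fun i => b i q) (fun i => c i q)) p =
      det3 (fun i => dx (a i) p) (fun i => b i p) (fun i => c i p) +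
      det3 (fun i => a i p) (fun i => dx (b i) p) (fun i => c i p) +
      det3 (fun i => a i p) (fun i => b i p) (fun i => dx (c i) p) := by
  have a0 := ha 0; have a1 := ha 1; have a2 := ha 2
  have b0 := hb 0; have b1 := hb 1; have b2 := hb 2
  have c0 := hc 0; have c1 := hc 1; have c2 := hc 2
  simp only [det3_eq]
  simp (disch := fun_prop) only [dx_add, dx_sub, dx_mul]
  ring

theorem contDiffOn_det3 {a b c : Fin 3 → ℝ × ℝ → ℝ} {Ω : Set (ℝ × ℝ)}
    (ha : ∀ i, ContDiffOn ℝ ∞ (a i) Ω) (hb : ∀ i, ContDiffOn ℝ ∞ (b i) Ω)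
    (hc : ∀ i, ContDiffOn ℝ ∞ (c i) Ω) :
    ContDiffOn ℝ ∞ (fun q => det3 (fun i => a i q) (fun i => b i q) (fun i => c i q)) Ω := by
  have a0 := ha 0; have a1 := ha 1; have a2 := ha 2
  have b0 := hb 0; have b1 := hb 1; have b2 := hb 2
  have c0 := hc 0; have c1 := hc 1; have c2 := hc 2
  simp only [det3_eq]
  fun_prop

/-! ### The linear system and its connection -/

/-- The coefficients of a vector field of the no-go form are smooth on `Ω`. -/
structure Coeffs.IsSmooth (q : Coeffs) (Ω : Set (ℝ × ℝ)) : Prop where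
  ξ₀ : ContDiffOn ℝ ∞ q.ξ₀ Ω
  η₁ : ContDiffOn ℝ ∞ q.η₁ Ω
  η₀ : ContDiffOn ℝ ∞ q.η₀ Ω

/-- The determining equations for the coefficients of a reduction operator of the no-go form. -/
structure Coeffs.IsDetermining (q : Coeffs) (p : ℝ × ℝ) : Prop where
  ξ₀ : dt q.ξ₀ p + dx (dx q.ξ₀) p + 2 * q.ξ₀ p * dx q.ξ₀ p - 2 * dx q.η₁ p = 0
  η₁ : dt q.η₁ p + dx (dx q.η₁) p + 2 * dx q.ξ₀ p * q.η₁ p + dx q.η₀ p = 0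
  η₀ : dt q.η₀ p + dx (dx q.η₀) p + 2 * dx q.ξ₀ p * q.η₀ p = 0

/-- The smooth common solutions of the heat equation `v_t + v_xx = 0` and of the linear equation
`v_xxx = ξ⁰ v_xx - η¹ v_x - η⁰ v / 2` associated with an operator of the no-go form. -/
structure Coeffs.IsLinearSolution (q : Coeffs) (Ω : Set (ℝ × ℝ)) (v : ℝ × ℝ → ℝ) : Prop where
  smooth : ContDiffOn ℝ ∞ v Ω
  heat : ∀ p ∈ Ω, dt v p + dx (dx v) p = 0
  third : ∀ p ∈ Ω, dx (dx (dx v)) p =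
    q.ξ₀ p * dx (dx v) p - q.η₁ p * dx v p - q.η₀ p / 2 * v p

/-- The matrix `M` of the system `y_x = M y` for `y = (v, v_x, v_xx)`. -/
noncomputable def Coeffs.connX (q : Coeffs) (p : ℝ × ℝ) : Matrix (Fin 3) (Fin 3) ℝ :=
  !![0, 1, 0; 0, 0, 1; -q.η₀ p / 2, -q.η₁ p, q.ξ₀ p]

/-- The matrix `N` of the system `y_t = N y` for `y = (v, v_x, v_xx)`. -/
noncomputable def Coeffs.connT (q : Coeffs) (p : ℝ × ℝ) : Matrix (Fin 3) (Fin 3) ℝ :=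
  !![0, 0, -1; q.η₀ p / 2, q.η₁ p, -q.ξ₀ p;
    dx q.η₀ p / 2 + q.ξ₀ p * q.η₀ p / 2, q.η₀ p / 2 + dx q.η₁ p + q.ξ₀ p * q.η₁ p,
    q.η₁ p - dx q.ξ₀ p - q.ξ₀ p ^ 2]

/-- `y` is a projectively parallel section on `U`: `y_x = M y - λ y` and `y_t = N y - μ y`. -/
structure Coeffs.IsProjParallel (q : Coeffs) (U : Set (ℝ × ℝ)) (lam mu : ℝ × ℝ → ℝ)
    (y : Fin 3 → ℝ × ℝ → ℝ) : Prop where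
  diff : ∀ k, ∀ p ∈ U, DifferentiableAt ℝ (y k) p
  eqX : ∀ k, ∀ p ∈ U, dx (y k) p = ∑ l, q.connX p k l * y l p - lam p * y k p
  eqT : ∀ k, ∀ p ∈ U, dt (y k) p = ∑ l, q.connT p k l * y l p - mu p * y k p

section

variable {q : Coeffs} {Ω U : Set (ℝ × ℝ)} {v : ℝ × ℝ → ℝ}

theorem Coeffs.IsSmooth.mono (hq : q.IsSmooth Ω) (h : U ⊆ Ω) : q.IsSmooth U :=
  ⟨hq.ξ₀.mono h, hq.η₁.mono h, hq.η₀.mono h⟩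

theorem Coeffs.IsLinearSolution.dx_third (hq : q.IsSmooth Ω) (hΩ : IsOpen Ω)
    (hv : q.IsLinearSolution Ω v) {p : ℝ × ℝ} (hp : p ∈ Ω) : dx (dx (dx (dx v))) p =
      dx q.ξ₀ p * dx (dx v) p + q.ξ₀ p * dx (dx (dx v)) p
      - (dx q.η₁ p * dx v p + q.η₁ p * dx (dx v) p)
      - (dx q.η₀ p / 2 * v p + q.η₀ p / 2 * dx v p) := by
  have d := fun {f : ℝ × ℝ → ℝ} (hf : ContDiffOn ℝ ∞ f Ω) => differentiableAt_of_contDiffOn hΩ hf hp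
  have s1 := contDiffOn_dx hΩ hv.smooth
  have dv := d hv.smooth
  have dv1 := d s1
  have dv2 := d (contDiffOn_dx hΩ s1)
  have dξ := d hq.ξ₀
  have dη₁ := d hq.η₁
  have dη₀ := d hq.η₀
  rw [dx_congr hΩ hv.third hp]
  simp (disch := fun_prop) only [div_eq_mul_inv, dx_sub, dx_mul, dx_const]
  ring

theorem Coeffs.IsLinearSolution.dt_eq (hv : q.IsLinearSolution Ω v) {p : ℝ × ℝ} (hp : p ∈ Ω) :
    dt v p = -dx (dx v) p := by linarith [hv.heat p hp]

theorem dt_dx_eq_neg (hΩ : IsOpen Ω) {f g : ℝ × ℝ → ℝ} (hf : ContDiffOn ℝ ∞ f Ω)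
    (h : ∀ p ∈ Ω, dt f p = -g p) {p : ℝ × ℝ} (hp : p ∈ Ω) : dt (dx f) p = -dx g p := by
  rw [dt_dx_comm hΩ hf hp, dx_congr hΩ h hp, dx_neg]

/-- The prolongation of a solution of the linear system is parallel. -/
theorem Coeffs.IsLinearSolution.isProjParallel (hq : q.IsSmooth Ω) (hΩ : IsOpen Ω)
    (hv : q.IsLinearSolution Ω v) :
    q.IsProjParallel Ω 0 0 fun k => dx^[k] v := by
  have s1 := contDiffOn_dx hΩ hv.smooth
  -- The rows of `N` come from `v_t = -v_xx` by differentiating in `x` and removing third and fourth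
  -- derivatives with the third-order equation.
  have h1 := fun p (hp : p ∈ Ω) => dt_dx_eq_neg hΩ hv.smooth (fun p hp => hv.dt_eq hp) hp
  have h2 := fun p (hp : p ∈ Ω) => dt_dx_eq_neg hΩ s1 h1 hp
  refine ⟨fun k p hp => differentiableAt_of_contDiffOn hΩ
    (contDiffOn_iterate_dx hΩ hv.smooth k) hp, fun k p hp => ?_, fun k p hp => ?_⟩
  · fin_cases k
    · simp [connX, Fin.sum_univ_three]
    · simp [connX, Fin.sum_univ_three]
    · simp [connX, Fin.sum_univ_three, hv.third p hp]
      ring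
  · fin_cases k
    · simp [connT, Fin.sum_univ_three, hv.dt_eq hp]
    · simp [connT, Fin.sum_univ_three, h1 p hp, hv.third p hp]
      ring
    · simp [connT, Fin.sum_univ_three, h2 p hp, hv.dx_third hq hΩ hp, hv.third p hp]
      ring

end

/-! ### Wronskian triples and their third-order equation -/

section

variable {q : Coeffs} {Ω U : Set (ℝ × ℝ)} {v : Fin 3 → ℝ × ℝ → ℝ}

/-- The matrix with rows `(vⁱ, vⁱ_x, vⁱ_xx)`. -/
noncomputable def jetMatrix (v : Fin 3 → ℝ × ℝ → ℝ) (p : ℝ × ℝ) : Matrix (Fin 3) (Fin 3) ℝ :=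
  Matrix.of fun i k => (dx^[k] (v i)) p

theorem wronskian_eq_det_jetMatrix (v : Fin 3 → ℝ × ℝ → ℝ) (p : ℝ × ℝ) :
    wronskian v p = (jetMatrix v p).det := by
  rw [wronskian, det3]
  congr 1
  ext i j
  fin_cases j <;> simp [jetMatrix, col]

theorem IsHeatTriple.det_ne_zero (hv : IsHeatTriple Ω v) {p : ℝ × ℝ} (hp : p ∈ Ω) :
    (jetMatrix v p).det ≠ 0 := by
  rw [← wronskian_eq_det_jetMatrix]; exact hv.wronskian_ne_zero p hp

/-- Column-wise differentiation produces three determinants, two of which have a repeated column. -/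
theorem dx_wronskian (hΩ : IsOpen Ω) (hv : ∀ i, ContDiffOn ℝ ∞ (v i) Ω) {p : ℝ × ℝ} (hp : p ∈ Ω) :
    dx (wronskian v) p = det3 (col v 0 p) (col v 1 p) (col v 3 p) := by
  have d := fun k i => differentiableAt_of_contDiffOn hΩ (contDiffOn_iterate_dx hΩ (hv i) k) hp
  refine (dx_det3 (d 0) (d 1) (d 2)).trans ?_
  simp only [det3_eq, col, Function.iterate_succ_apply', Function.iterate_zero_apply]
  ring

theorem contDiffOn_wronskian (hΩ : IsOpen Ω) (hv : ∀ i, ContDiffOn ℝ ∞ (v i) Ω) :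
    ContDiffOn ℝ ∞ (wronskian v) Ω :=
  contDiffOn_det3 (fun i => contDiffOn_iterate_dx hΩ (hv i) 0)
    (fun i => contDiffOn_iterate_dx hΩ (hv i) 1) (fun i => contDiffOn_iterate_dx hΩ (hv i) 2)

theorem wronskianCoeffs_isSmooth (hΩ : IsOpen Ω) (hv : IsHeatTriple Ω v) :
    (wronskianCoeffs Ω v).IsSmooth Ω := by
  have hW := contDiffOn_wronskian hΩ hv.smooth
  have hc := fun k i => contDiffOn_iterate_dx hΩ (hv.smooth i) k
  have h : ∀ f : ℝ × ℝ → ℝ, ContDiffOn ℝ ∞ f Ω →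
      ContDiffOn ℝ ∞ (Ω.indicator fun p => f p / wronskian v p) Ω := fun f hf =>
    (hf.div hW hv.wronskian_ne_zero).congr fun p hp => indicator_of_mem hp _
  exact ⟨h _ (contDiffOn_dx hΩ hW), h _ (contDiffOn_det3 (hc 0) (hc 2) (hc 3)),
    h _ (contDiffOn_const.mul (contDiffOn_wronskian hΩ fun i => contDiffOn_dx hΩ (hv.smooth i)))⟩

/-- Cramer's rule: the column of third derivatives is expanded in the columns of orders 2, 1 and 0,
and the coefficients are the Wronskian quotients. -/
theorem IsHeatTriple.isLinearSolution (hΩ : IsOpen Ω) (hv : IsHeatTriple Ω v) (i : Fin 3) :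
    (wronskianCoeffs Ω v).IsLinearSolution Ω (v i) := by
  refine ⟨hv.smooth i, hv.heat i, fun p hp => ?_⟩
  have hW := hv.wronskian_ne_zero p hp
  simp only [wronskianCoeffs, indicator_of_mem hp]
  rw [dx_wronskian hΩ hv.smooth hp]
  field_simp
  simp only [wronskian, det3_eq, col, Function.iterate_succ_apply', Function.iterate_zero_apply]
  fin_cases i <;> simp only [Fin.zero_eta, Fin.mk_one, Fin.reduceFinMk] <;> ring

/-- A triple of solutions of the linear system determines the coefficients. -/
theorem eq_wronskianCoeffs_of_isLinearSolution (hΩ : IsOpen Ω) (hv : IsHeatTriple Ω v)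
    (hq : ∀ i, q.IsLinearSolution Ω (v i))
    (h0 : ∀ p, p ∉ Ω → q.ξ₀ p = 0 ∧ q.η₁ p = 0 ∧ q.η₀ p = 0) : q = wronskianCoeffs Ω v := by
  -- Inserting this expression for the third-derivative column into each numerator leaves one
  -- multiple of the Wronskian; the other terms have repeated columns.
  have key : ∀ p ∈ Ω, ∀ i, col v 3 p i =
      q.ξ₀ p * col v 2 p i - q.η₁ p * col v 1 p i - q.η₀ p / 2 * col v 0 p i := fun p hp i =>
    (hq i).third p hp
  have hcol : ∀ k p, col (fun i => dx (v i)) k p = col v (k + 1) p := fun k p => rfl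
  ext p
  all_goals
    by_cases hp : p ∈ Ω
    · have hW := hv.wronskian_ne_zero p hp
      simp only [wronskianCoeffs, indicator_of_mem hp]
      rw [eq_div_iff hW]
      try rw [dx_wronskian hΩ hv.smooth hp]
      simp only [wronskian, hcol, det3_eq, key p hp, Nat.reduceAdd]
      ring
    · simp only [wronskianCoeffs, indicator_of_notMem hp]
      simp [h0 p hp]

end

/-! ### Compatibility conditions and projectively parallel sections -/

section

variable {q : Coeffs} {Ω U : Set (ℝ × ℝ)} {v : Fin 3 → ℝ × ℝ → ℝ}

/-- The function `v_xxxt` is computed twice: as minus the fifth `x`-derivative, by the heat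
equation, and by differentiating the third-order equation in `t`. Once all derivatives of order
above two are eliminated, the residuals of the determining equations remain as coefficients. -/
theorem Coeffs.IsLinearSolution.residual_eq_zero (hq : q.IsSmooth Ω) (hΩ : IsOpen Ω)
    {v : ℝ × ℝ → ℝ} (hv : q.IsLinearSolution Ω v) {p : ℝ × ℝ} (hp : p ∈ Ω) :
    (dt q.ξ₀ p + dx (dx q.ξ₀) p + 2 * q.ξ₀ p * dx q.ξ₀ p - 2 * dx q.η₁ p) * dx (dx v) p
      - (dt q.η₁ p + dx (dx q.η₁) p + 2 * dx q.ξ₀ p * q.η₁ p + dx q.η₀ p) * dx v p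
      - (dt q.η₀ p + dx (dx q.η₀) p + 2 * dx q.ξ₀ p * q.η₀ p) / 2 * v p = 0 := by
  have d := fun {f : ℝ × ℝ → ℝ} (hf : ContDiffOn ℝ ∞ f Ω) => differentiableAt_of_contDiffOn hΩ hf hp
  have s1 := contDiffOn_dx hΩ hv.smooth
  have s2 := contDiffOn_dx hΩ s1
  have s3 := contDiffOn_dx hΩ s2
  have h1 := fun p (hp : p ∈ Ω) => dt_dx_eq_neg hΩ hv.smooth (fun p hp => hv.dt_eq hp) hp
  have h2 := fun p (hp : p ∈ Ω) => dt_dx_eq_neg hΩ s1 h1 hp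
  have h3 := dt_dx_eq_neg hΩ s2 h2 hp
  have dv := d hv.smooth
  have dv1 := d s1
  have dv2 := d s2
  have dv3 := d s3
  have dξ := d hq.ξ₀
  have dη₁ := d hq.η₁
  have dη₀ := d hq.η₀
  have dξ' := d (contDiffOn_dx hΩ hq.ξ₀)
  have dη₁' := d (contDiffOn_dx hΩ hq.η₁)
  have dη₀' := d (contDiffOn_dx hΩ hq.η₀)
  have e5 := dx_congr hΩ (fun p hp => hv.dx_third hq hΩ hp) hp
  have et := dt_congr hΩ hv.third hp
  simp (disch := fun_prop) only [div_eq_mul_inv, dx_sub, dx_add, dx_mul, dx_const] at e5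
  simp (disch := fun_prop) only [div_eq_mul_inv, dt_sub, dt_mul, dt_const] at et
  rw [h3, h2 p hp, h1 p hp, hv.dt_eq hp, e5, hv.dx_third hq hΩ hp] at et
  simp only [hv.third p hp] at et
  linear_combination -et

/-- The residual relation is linear in `(v, v_x, v_xx)` and holds for three independent such vectors
at each point, so all residuals vanish. -/
theorem isDetermining_of_isLinearSolution (hq : q.IsSmooth Ω) (hΩ : IsOpen Ω)
    (hv : ∀ i, q.IsLinearSolution Ω (v i)) (hdet : ∀ p ∈ Ω, (jetMatrix v p).det ≠ 0)
    {p : ℝ × ℝ} (hp : p ∈ Ω) : q.IsDetermining p := by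
  have h := Matrix.eq_zero_of_mulVec_eq_zero (hdet p hp) (v :=
    ![-(dt q.η₀ p + dx (dx q.η₀) p + 2 * dx q.ξ₀ p * q.η₀ p) / 2,
      -(dt q.η₁ p + dx (dx q.η₁) p + 2 * dx q.ξ₀ p * q.η₁ p + dx q.η₀ p),
      dt q.ξ₀ p + dx (dx q.ξ₀) p + 2 * q.ξ₀ p * dx q.ξ₀ p - 2 * dx q.η₁ p]) (by
    funext i
    have := (hv i).residual_eq_zero hq hΩ hp
    simp [Matrix.mulVec, dotProduct, Fin.sum_univ_three, jetMatrix]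
    linear_combination this)
  have h0 := congrFun h 0
  have h1 := congrFun h 1
  have h2 := congrFun h 2
  simp at h0 h1 h2
  exact ⟨by linarith, by linarith, by linarith⟩

theorem differentiableAt_matrix_inv {X : ℝ × ℝ → Matrix (Fin 3) (Fin 3) ℝ} {p : ℝ × ℝ}
    (hX : ∀ i j, DifferentiableAt ℝ (fun p => X p i j) p) (hdet : (X p).det ≠ 0) (i j : Fin 3) :
    DifferentiableAt ℝ (fun p => (X p)⁻¹ i j) p := by
  have hd : DifferentiableAt ℝ (fun p => (X p).det) p := by
    simp only [Matrix.det_fin_three]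
    fun_prop
  have ha : DifferentiableAt ℝ (fun p => (X p).adjugate i j) p := by
    simp only [Matrix.adjugate_fin_three]
    fin_cases i <;> fin_cases j <;> simp <;> fun_prop
  simp only [Matrix.inv_def, Ring.inverse_eq_inv', Matrix.smul_apply, smul_eq_mul]
  exact (hd.inv hdet).mul ha

/-- The coordinates of a projectively parallel section in a parallel frame. -/
theorem Coeffs.IsProjParallel.exists_coords {V : Fin 3 → Fin 3 → ℝ × ℝ → ℝ}
    {lam mu : ℝ × ℝ → ℝ} {y : Fin 3 → ℝ × ℝ → ℝ} (hU : IsOpen U)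
    (hV : ∀ i, q.IsProjParallel U 0 0 (V i))
    (hdet : ∀ p ∈ U, (Matrix.of fun i k => V i k p).det ≠ 0)
    (hy : q.IsProjParallel U lam mu y) :
    ∃ c : Fin 3 → ℝ × ℝ → ℝ, (∀ i, ∀ p ∈ U, DifferentiableAt ℝ (c i) p) ∧
      (∀ i, ∀ p ∈ U, dx (c i) p = -lam p * c i p) ∧ (∀ i, ∀ p ∈ U, dt (c i) p = -mu p * c i p) ∧
      ∀ k, ∀ p ∈ U, ∑ i, c i p * V i k p = y k p := by
  let X : ℝ × ℝ → Matrix (Fin 3) (Fin 3) ℝ := fun p => Matrix.of fun i k => V i k p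
  let c : Fin 3 → ℝ × ℝ → ℝ := fun i p => ∑ k, y k p * (X p)⁻¹ k i
  have hc : ∀ i, ∀ p ∈ U, DifferentiableAt ℝ (c i) p := fun i p hp => by
    have h2 := fun k => differentiableAt_matrix_inv (X := X) (fun i j => (hV i).diff j p hp)
      (hdet p hp) k i
    exact DifferentiableAt.fun_sum fun k _ => (hy.diff k p hp).mul (h2 k)
  have hcX : ∀ k, ∀ p ∈ U, ∑ i, c i p * V i k p = y k p := by
    intro k p hp
    have h1 : (fun i => c i p) = Matrix.vecMul (fun k => y k p) (X p)⁻¹ := rfl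
    have h2 : Matrix.vecMul (fun i => c i p) (X p) = fun k => y k p := by
      rw [h1, Matrix.vecMul_vecMul, Matrix.nonsing_inv_mul _ (isUnit_iff_ne_zero.2 (hdet p hp)),
        Matrix.vecMul_one]
    exact congrFun h2 k
  -- Differentiating `y = c X`, the connection terms cancel because the rows of `X` are parallel;
  -- what remains is `(c' + l c) X = 0`. The same argument serves both variables.
  have aux : ∀ p ∈ U, ∀ (L : Matrix (Fin 3) (Fin 3) ℝ) (l : ℝ) (c' : Fin 3 → ℝ),
      (∀ k, ∑ i, (c' i * V i k p + c i p * ∑ j, L k j * V i j p) =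
        ∑ j, L k j * y j p - l * y k p) → ∀ i, c' i = -l * c i p := by
    intro p hp L l c' h i
    have hz := Matrix.eq_zero_of_vecMul_eq_zero (hdet p hp) (v := fun i => c' i + l * c i p) (by
      funext k
      have hk := h k
      have e0 := hcX 0 p hp
      have e1 := hcX 1 p hp
      have e2 := hcX 2 p hp
      have ek := hcX k p hp
      simp only [Fin.sum_univ_three] at hk e0 e1 e2 ek
      simp only [Matrix.vecMul, dotProduct, Fin.sum_univ_three, Matrix.of_apply, Pi.zero_apply]
      linear_combination hk - L k 0 * e0 - L k 1 * e1 - L k 2 * e2 + l * ek)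
    linarith [congrFun hz i, show (0 : Fin 3 → ℝ) i = 0 from rfl]
  refine ⟨c, hc, fun i p hp => ?_, fun i p hp => ?_, hcX⟩
  · refine aux p hp (q.connX p) (lam p) (fun i => dx (c i) p) (fun k => ?_) i
    rw [← hy.eqX k p hp, ← dx_congr hU (fun p hp => hcX k p hp) hp,
      dx_sum_mul (fun i => hc i p hp) (fun i => (hV i).diff k p hp)]
    refine Finset.sum_congr rfl fun i _ => ?_
    rw [(hV i).eqX k p hp]
    simp
  · refine aux p hp (q.connT p) (mu p) (fun i => dt (c i) p) (fun k => ?_) i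
    rw [← hy.eqT k p hp, ← dt_congr hU (fun p hp => hcX k p hp) hp,
      dt_sum_mul (fun i => hc i p hp) (fun i => (hV i).diff k p hp)]
    refine Finset.sum_congr rfl fun i _ => ?_
    rw [(hV i).eqT k p hp]
    simp

/-- On a connected set, a projectively parallel section is a multiple of a constant combination of
a parallel frame. -/
theorem Coeffs.IsProjParallel.exists_const_direction {V : Fin 3 → Fin 3 → ℝ × ℝ → ℝ}
    {lam mu : ℝ × ℝ → ℝ} {y : Fin 3 → ℝ × ℝ → ℝ} (hU : IsOpen U) (hUc : IsConnected U)
    (hV : ∀ i, q.IsProjParallel U 0 0 (V i))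
    (hdet : ∀ p ∈ U, (Matrix.of fun i k => V i k p).det ≠ 0)
    (hy : q.IsProjParallel U lam mu y) (hy0 : ∀ p ∈ U, ∃ k, y k p ≠ 0) :
    ∃ k : Fin 3 → ℝ, k ≠ 0 ∧ ∃ h : ℝ × ℝ → ℝ,
      ∀ p ∈ U, ∀ j, h p * ∑ i, k i * V i j p = y j p := by
  obtain ⟨c, hc, hcx, hct, hcV⟩ := hy.exists_coords hU hV hdet
  have hcne : ∀ p ∈ U, ∃ i, c i p ≠ 0 := by
    intro p hp
    by_contra! h
    obtain ⟨k, hk⟩ := hy0 p hp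
    exact hk (by rw [← hcV k p hp]; simp [h])
  let n : ℝ × ℝ → ℝ := fun p => ∑ i, c i p * c i p
  have hn0 : ∀ p ∈ U, n p ≠ 0 := by
    intro p hp
    obtain ⟨i, hi⟩ := hcne p hp
    have : 0 < c i p * c i p := mul_self_pos.2 hi
    exact (lt_of_lt_of_le this (Finset.single_le_sum (f := fun i => c i p * c i p)
      (fun i _ => mul_self_nonneg _) (Finset.mem_univ i))).ne'
  have hn : ∀ p ∈ U, DifferentiableAt ℝ n p := fun p hp =>
    DifferentiableAt.fun_sum fun i _ => (hc i p hp).mul (hc i p hp)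
  have hnx : ∀ p ∈ U, dx n p = -2 * lam p * n p := by
    intro p hp
    refine (dx_sum_mul (fun i => hc i p hp) (fun i => hc i p hp)).trans ?_
    rw [Finset.mul_sum]
    refine Finset.sum_congr rfl fun i _ => ?_
    rw [hcx i p hp]
    ring
  have hnt : ∀ p ∈ U, dt n p = -2 * mu p * n p := by
    intro p hp
    refine (dt_sum_mul (fun i => hc i p hp) (fun i => hc i p hp)).trans ?_
    rw [Finset.mul_sum]
    refine Finset.sum_congr rfl fun i _ => ?_
    rw [hct i p hp]
    ring
  -- All coordinates satisfy the same scalar equations `c_x = -λ c`, `c_t = -μ c`, so expressions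
  -- homogeneous of degree zero in `c` have zero derivative. These are the entries of the orthogonal
  -- projection onto the line of `c`.
  let g : Fin 3 → Fin 3 → ℝ × ℝ → ℝ := fun i j p => c i p * c j p / n p
  have hg : ∀ i j, ∀ p ∈ U, DifferentiableAt ℝ (g i j) p := fun i j p hp =>
    ((hc i p hp).mul (hc j p hp)).mul ((hn p hp).inv (hn0 p hp))
  have hgn : ∀ i j, EqOn (fun p => g i j p * n p) (fun p => c i p * c j p) U := fun i j p hp =>
    div_mul_cancel₀ _ (hn0 p hp)
  have hgx : ∀ i j, ∀ p ∈ U, dx (g i j) p = 0 := by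
    intro i j p hp
    have h := dx_congr hU (hgn i j) hp
    rw [dx_mul (hg i j p hp) (hn p hp), dx_mul (hc i p hp) (hc j p hp), hnx p hp, hcx i p hp,
      hcx j p hp] at h
    have h2 : g i j p * n p = c i p * c j p := hgn i j hp
    have h3 : dx (g i j) p * n p = 0 := by linear_combination h + 2 * lam p * h2
    exact (mul_eq_zero.1 h3).resolve_right (hn0 p hp)
  have hgt : ∀ i j, ∀ p ∈ U, dt (g i j) p = 0 := by
    intro i j p hp
    have h := dt_congr hU (hgn i j) hp
    rw [dt_mul (hg i j p hp) (hn p hp), dt_mul (hc i p hp) (hc j p hp), hnt p hp, hct i p hp,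
      hct j p hp] at h
    have h2 : g i j p * n p = c i p * c j p := hgn i j hp
    have h3 : dt (g i j) p * n p = 0 := by linear_combination h + 2 * mu p * h2
    exact (mul_eq_zero.1 h3).resolve_right (hn0 p hp)
  obtain ⟨p₀, hp₀⟩ := hUc.nonempty
  obtain ⟨i₀, hi₀⟩ := hcne p₀ hp₀
  have hconst : ∀ j, ∀ p ∈ U, g i₀ j p = g i₀ j p₀ := fun j p hp =>
    eq_of_dt_dx_eq_zero hU hUc.isPreconnected (hg i₀ j) (hgt i₀ j) (hgx i₀ j) hp hp₀
  have hii : g i₀ i₀ p₀ ≠ 0 := div_ne_zero (mul_ne_zero hi₀ hi₀) (hn0 p₀ hp₀)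
  -- The row `i₀` of the projection spans the line of `c`. Its diagonal entry is a nonzero constant,
  -- so `c i₀` has no zero on `U` and may be divided by.
  refine ⟨fun j => g i₀ j p₀, fun h => hii (congrFun h i₀), fun p => n p / c i₀ p,
    fun p hp j => ?_⟩
  have hci : c i₀ p ≠ 0 := by
    intro h
    apply hii
    rw [← hconst i₀ p hp]
    simp [g, h]
  rw [← hcV j p hp, Finset.mul_sum]
  refine Finset.sum_congr rfl fun i _ => ?_
  change n p / c i₀ p * (g i₀ i p₀ * V i j p) = _
  rw [← hconst i p hp]
  have := hn0 p hp
  simp only [g]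
  field_simp

end

/-! ### The Hopf-Cole correspondence -/

section Invariant

variable {q : Coeffs} {Ω U : Set (ℝ × ℝ)}

theorem burgersL_jet (u : ℝ × ℝ → ℝ) (p : ℝ × ℝ) :
    burgersL (jet u p) = dt u p + u p * dx u p + dx (dx u) p := rfl

theorem char_jet (q : Coeffs) (u : ℝ × ℝ → ℝ) (p : ℝ × ℝ) : q.field.char (jet u p) =
    1 / 4 * u p ^ 3 - q.ξ₀ p / 2 * u p ^ 2 + q.η₁ p * u p + q.η₀ p - dt u p
      - (-(1 / 2) * u p + q.ξ₀ p) * dx u p := by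
  simp [VField.char, Coeffs.field, jet, Jet.base]

/-- The projectively parallel section `(1, u/2, u_x/2 + u²/4)` given by a function `u`. -/
noncomputable def logSection (u : ℝ × ℝ → ℝ) : Fin 3 → ℝ × ℝ → ℝ :=
  ![fun _ => 1, fun p => 1 / 2 * u p, fun p => 1 / 2 * dx u p + 1 / 4 * (u p * u p)]

/-- If `u = 2 w_x / w`, this section is `(w, w_x, w_xx)` divided by `w`. That explains the
multipliers `λ = w_x / w = u/2` and `μ = w_t / w = -w_xx / w`. The verification uses only `u`, so no
`w` has to be found beforehand. -/
theorem isProjParallel_logSection (hq : q.IsSmooth U) (hU : IsOpen U) {u : ℝ × ℝ → ℝ}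
    (hu : ContDiffOn ℝ ∞ u U) (hL : ∀ p ∈ U, burgersL (jet u p) = 0)
    (hQ : ∀ p ∈ U, q.field.char (jet u p) = 0) :
    q.IsProjParallel U (logSection u 1) (fun p => -logSection u 2 p) (logSection u) := by
  have d := fun {f : ℝ × ℝ → ℝ} (hf : ContDiffOn ℝ ∞ f U) {p} hp =>
    differentiableAt_of_contDiffOn (p := p) hU hf hp
  have s1 := contDiffOn_dx hU hu
  have ht : ∀ p ∈ U, dt u p = 1 / 4 * (u p * u p * u p) - 1 / 2 * (q.ξ₀ p * (u p * u p))
      + q.η₁ p * u p + q.η₀ p - (q.ξ₀ p - 1 / 2 * u p) * dx u p := fun p hp => by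
    have := hQ p hp
    rw [char_jet] at this
    linear_combination -this
  have hxx : ∀ p ∈ U, dx (dx u) p = -dt u p - u p * dx u p := fun p hp => by
    have := hL p hp
    rw [burgersL_jet] at this
    linarith
  refine ⟨fun k p hp => ?_, fun k p hp => ?_, fun k p hp => ?_⟩
  · have du := d hu hp
    have du1 := d s1 hp
    fin_cases k <;> simp [logSection] <;> fun_prop
  · have du := d hu hp
    have du1 := d s1 hp
    fin_cases k
    · simp [logSection, Coeffs.connX, Fin.sum_univ_three, dx_const]
    · simp (disch := fun_prop) only [logSection, Coeffs.connX, Fin.sum_univ_three, dx_mul, dx_const,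
        Matrix.of_apply, Matrix.cons_val', Matrix.cons_val, Fin.mk_one]
      ring
    · simp (disch := fun_prop) only [logSection, Coeffs.connX, Fin.sum_univ_three, dx_mul, dx_const,
        dx_add, Matrix.of_apply, Matrix.cons_val', Matrix.cons_val, Fin.reduceFinMk]
      rw [hxx p hp, ht p hp]
      ring
  · have du := d hu hp
    have du1 := d s1 hp
    have dξ := d hq.ξ₀ hp
    have dη₁ := d hq.η₁ hp
    have dη₀ := d hq.η₀ hp
    fin_cases k
    · simp [logSection, Coeffs.connT, Fin.sum_univ_three, dt_const]
    · simp (disch := fun_prop) only [logSection, Coeffs.connT, Fin.sum_univ_three, dt_mul, dt_const,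
        Matrix.of_apply, Matrix.cons_val', Matrix.cons_val, Fin.mk_one]
      rw [ht p hp]
      ring
    · simp (disch := fun_prop) only [logSection, Coeffs.connT, Fin.sum_univ_three, dt_mul, dt_const,
        dt_add, Matrix.of_apply, Matrix.cons_val', Matrix.cons_val, Fin.reduceFinMk]
      rw [dt_dx_comm hU hu hp, dx_congr hU ht hp]
      simp (disch := fun_prop) only [dx_add, dx_sub, dx_mul, dx_const]
      rw [hxx p hp, ht p hp]
      ring

/-- The Hopf-Cole transformation: a nonvanishing solution of the linear system gives an invariant
solution of the Burgers equation. -/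
theorem Coeffs.IsLinearSolution.invariant (hU : IsOpen U) {w u : ℝ × ℝ → ℝ}
    (hw : q.IsLinearSolution U w) (hw0 : ∀ p ∈ U, w p ≠ 0)
    (hu : ∀ p ∈ U, u p = 2 * dx w p / w p) :
    ContDiffOn ℝ ∞ u U ∧ ∀ p ∈ U, burgersL (jet u p) = 0 ∧ q.field.char (jet u p) = 0 := by
  have s1 := contDiffOn_dx hU hw.smooth
  have su : ContDiffOn ℝ ∞ u U :=
    ((contDiffOn_const.mul s1).div hw.smooth hw0).congr hu
  refine ⟨su, fun p hp => ?_⟩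
  have d := fun {f : ℝ × ℝ → ℝ} (hf : ContDiffOn ℝ ∞ f U) {p} hp =>
    differentiableAt_of_contDiffOn (p := p) hU hf hp
  -- Differentiating the product `u w = 2 w_x` avoids derivatives of quotients.
  have e0 : ∀ p ∈ U, u p * w p = 2 * dx w p := fun p hp => by
    rw [hu p hp, div_mul_cancel₀ _ (hw0 p hp)]
  have e1 : ∀ p ∈ U, dx u p * w p + u p * dx w p = 2 * dx (dx w) p := fun p hp => by
    have du := d su hp
    have dw := d hw.smooth hp
    have dw1 := d s1 hp
    have h := dx_congr hU e0 hp
    simp (disch := fun_prop) only [dx_mul, dx_const] at h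
    linarith
  have e2 : dx (dx u) p * w p + 2 * (dx u p * dx w p) + u p * dx (dx w) p =
      2 * dx (dx (dx w)) p := by
    have du := d su hp
    have du1 := d (contDiffOn_dx hU su) hp
    have dw := d hw.smooth hp
    have dw1 := d s1 hp
    have dw2 := d (contDiffOn_dx hU s1) hp
    have h := dx_congr hU e1 hp
    simp (disch := fun_prop) only [dx_mul, dx_const, dx_add] at h
    linarith
  have e3 : dt u p * w p - u p * dx (dx w) p = -2 * dx (dx (dx w)) p := by
    have du := d su hp
    have dw := d hw.smooth hp
    have dw1 := d s1 hp
    have h := dt_congr hU e0 hp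
    simp (disch := fun_prop) only [dt_mul, dt_const] at h
    rw [dt_dx_eq_neg hU hw.smooth (fun p hp => hw.dt_eq hp) hp, hw.dt_eq hp] at h
    linarith
  have hwp := hw0 p hp
  -- The derivatives of `w` become multiples of `w`. In `e2 + e3` the third derivative cancels and
  -- the Burgers equation times `w` is left; `e3` with the third-order equation gives the
  -- characteristic times `w`.
  have f0 : dx w p = u p / 2 * w p := by linarith [e0 p hp]
  have f1 : dx (dx w) p = (dx u p / 2 + u p ^ 2 / 4) * w p := by
    have := e1 p hp
    rw [f0] at this
    linarith
  have f2 := hw.third p hp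
  rw [f0, f1] at f2
  rw [f0, f1, f2] at e2
  rw [f1, f2] at e3
  rw [burgersL_jet, char_jet]
  constructor
  · refine (mul_eq_zero.1 (?_ : _ * w p = 0)).resolve_right hwp
    linear_combination e2 + e3
  · refine (mul_eq_zero.1 (?_ : _ * w p = 0)).resolve_right hwp
    linear_combination -e3

end Invariant

/-! ### The invariance criterion and the determining equations -/

section Criterion

variable {q : Coeffs} {Ω : Set (ℝ × ℝ)}

theorem isOpen_cylinder (hΩ : IsOpen Ω) : IsOpen {z : ℝ × ℝ × ℝ | (z.1, z.2.1) ∈ Ω} :=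
  hΩ.preimage (by fun_prop : Continuous fun z : ℝ × ℝ × ℝ => (z.1, z.2.1))

theorem contDiffOn_cylinder {f : ℝ × ℝ → ℝ} (hf : ContDiffOn ℝ ∞ f Ω) :
    ContDiffOn ℝ ∞ (fun z : ℝ × ℝ × ℝ => f (z.1, z.2.1)) {z | (z.1, z.2.1) ∈ Ω} :=
  hf.comp (g := f) (f := fun z : ℝ × ℝ × ℝ => (z.1, z.2.1))
    (by fun_prop : ContDiff ℝ ∞ fun z : ℝ × ℝ × ℝ => (z.1, z.2.1)).contDiffOn fun _ h => h

theorem pt_eq_dt {F : ℝ × ℝ × ℝ → ℝ} {z : ℝ × ℝ × ℝ} (hF : DifferentiableAt ℝ F z) :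
    pt F z = dt (fun p => F (p.1, p.2, z.2.2)) (z.1, z.2.1) := by
  have h := (hasFDerivAt_fst (𝕜 := ℝ) (p := (z.1, z.2.1))).prodMk
    ((hasFDerivAt_snd (𝕜 := ℝ) (p := (z.1, z.2.1))).prodMk
      (hasFDerivAt_const z.2.2 (z.1, z.2.1)))
  have := HasFDerivAt.comp (g := F) (z.1, z.2.1) hF.hasFDerivAt h
  rw [dt, show (fun p : ℝ × ℝ => F (p.1, p.2, z.2.2)) =
    F ∘ fun p : ℝ × ℝ => (p.1, p.2, z.2.2) from rfl, this.fderiv]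
  simp [pt]

theorem px_eq_dx {F : ℝ × ℝ × ℝ → ℝ} {z : ℝ × ℝ × ℝ} (hF : DifferentiableAt ℝ F z) :
    px F z = dx (fun p => F (p.1, p.2, z.2.2)) (z.1, z.2.1) := by
  have h := (hasFDerivAt_fst (𝕜 := ℝ) (p := (z.1, z.2.1))).prodMk
    ((hasFDerivAt_snd (𝕜 := ℝ) (p := (z.1, z.2.1))).prodMk
      (hasFDerivAt_const z.2.2 (z.1, z.2.1)))
  have := HasFDerivAt.comp (g := F) (z.1, z.2.1) hF.hasFDerivAt h
  rw [dx, show (fun p : ℝ × ℝ => F (p.1, p.2, z.2.2)) =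
    F ∘ fun p : ℝ × ℝ => (p.1, p.2, z.2.2) from rfl, this.fderiv]
  simp [px]

theorem pu_eq_deriv {F : ℝ × ℝ × ℝ → ℝ} {z : ℝ × ℝ × ℝ} (hF : DifferentiableAt ℝ F z) :
    pu F z = deriv (fun u => F (z.1, z.2.1, u)) z.2.2 :=
  (HasFDerivAt.comp_hasDerivAt z.2.2 (l := F) (f := fun u => (z.1, z.2.1, u)) hF.hasFDerivAt
    ((hasDerivAt_const _ _).prodMk ((hasDerivAt_const _ _).prodMk (hasDerivAt_id _)))).deriv.symm

/-- A cubic polynomial in `u` whose coefficients are functions of `(t, x)`. -/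
noncomputable def cubic (a b c d : ℝ × ℝ → ℝ) (z : ℝ × ℝ × ℝ) : ℝ :=
  a (z.1, z.2.1) + b (z.1, z.2.1) * z.2.2 + c (z.1, z.2.1) * (z.2.2 * z.2.2)
    + d (z.1, z.2.1) * (z.2.2 * z.2.2 * z.2.2)

variable {a b c d : ℝ × ℝ → ℝ} {z : ℝ × ℝ × ℝ}

theorem contDiffOn_cubic (ha : ContDiffOn ℝ ∞ a Ω) (hb : ContDiffOn ℝ ∞ b Ω)
    (hc : ContDiffOn ℝ ∞ c Ω) (hd : ContDiffOn ℝ ∞ d Ω) :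
    ContDiffOn ℝ ∞ (cubic a b c d) {z | (z.1, z.2.1) ∈ Ω} := by
  have ha := contDiffOn_cylinder ha
  have hb := contDiffOn_cylinder hb
  have hc := contDiffOn_cylinder hc
  have hd := contDiffOn_cylinder hd
  have hu : ContDiffOn ℝ ∞ (fun z : ℝ × ℝ × ℝ => z.2.2) {z | (z.1, z.2.1) ∈ Ω} := by fun_prop
  exact ((ha.add (hb.mul hu)).add (hc.mul (hu.mul hu))).add (hd.mul ((hu.mul hu).mul hu))

theorem differentiableAt_cubic (hΩ : IsOpen Ω) (ha : ContDiffOn ℝ ∞ a Ω)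
    (hb : ContDiffOn ℝ ∞ b Ω) (hc : ContDiffOn ℝ ∞ c Ω) (hd : ContDiffOn ℝ ∞ d Ω)
    (hz : (z.1, z.2.1) ∈ Ω) : DifferentiableAt ℝ (cubic a b c d) z :=
  ((contDiffOn_cubic ha hb hc hd).contDiffAt
    ((isOpen_cylinder hΩ).mem_nhds hz)).differentiableAt (by simp)

theorem pt_cubic (hΩ : IsOpen Ω) (ha : ContDiffOn ℝ ∞ a Ω) (hb : ContDiffOn ℝ ∞ b Ω)
    (hc : ContDiffOn ℝ ∞ c Ω) (hd : ContDiffOn ℝ ∞ d Ω) (hz : (z.1, z.2.1) ∈ Ω) :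
    pt (cubic a b c d) z = cubic (dt a) (dt b) (dt c) (dt d) z := by
  rw [pt_eq_dt (differentiableAt_cubic hΩ ha hb hc hd hz)]
  have ha := differentiableAt_of_contDiffOn hΩ ha hz
  have hb := differentiableAt_of_contDiffOn hΩ hb hz
  have hc := differentiableAt_of_contDiffOn hΩ hc hz
  have hd := differentiableAt_of_contDiffOn hΩ hd hz
  simp only [cubic, Prod.mk.eta]
  simp (disch := fun_prop) only [dt_add, dt_mul, dt_const]
  ring

theorem px_cubic (hΩ : IsOpen Ω) (ha : ContDiffOn ℝ ∞ a Ω) (hb : ContDiffOn ℝ ∞ b Ω)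
    (hc : ContDiffOn ℝ ∞ c Ω) (hd : ContDiffOn ℝ ∞ d Ω) (hz : (z.1, z.2.1) ∈ Ω) :
    px (cubic a b c d) z = cubic (dx a) (dx b) (dx c) (dx d) z := by
  rw [px_eq_dx (differentiableAt_cubic hΩ ha hb hc hd hz)]
  have ha := differentiableAt_of_contDiffOn hΩ ha hz
  have hb := differentiableAt_of_contDiffOn hΩ hb hz
  have hc := differentiableAt_of_contDiffOn hΩ hc hz
  have hd := differentiableAt_of_contDiffOn hΩ hd hz
  simp only [cubic, Prod.mk.eta]
  simp (disch := fun_prop) only [dx_add, dx_mul, dx_const]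
  ring

theorem pu_cubic (hΩ : IsOpen Ω) (ha : ContDiffOn ℝ ∞ a Ω) (hb : ContDiffOn ℝ ∞ b Ω)
    (hc : ContDiffOn ℝ ∞ c Ω) (hd : ContDiffOn ℝ ∞ d Ω) (hz : (z.1, z.2.1) ∈ Ω) :
    pu (cubic a b c d) z = cubic b (fun p => 2 * c p) (fun p => 3 * d p) (fun _ => 0) z := by
  rw [pu_eq_deriv (differentiableAt_cubic hΩ ha hb hc hd hz)]
  simp only [cubic]
  have h := hasDerivAt_id z.2.2
  refine ((((hasDerivAt_const z.2.2 (a (z.1, z.2.1))).add (h.const_mul (b (z.1, z.2.1)))).add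
    ((h.mul h).const_mul (c (z.1, z.2.1)))).add
    (((h.mul h).mul h).const_mul (d (z.1, z.2.1)))).deriv.trans ?_
  simp
  ring

theorem px_congr (hΩ : IsOpen Ω) {F G : ℝ × ℝ × ℝ → ℝ}
    (h : EqOn F G {z | (z.1, z.2.1) ∈ Ω}) (hz : (z.1, z.2.1) ∈ Ω) : px F z = px G z := by
  rw [px, px, (h.eventuallyEq_of_mem ((isOpen_cylinder hΩ).mem_nhds hz)).fderiv_eq]

theorem pu_congr (hΩ : IsOpen Ω) {F G : ℝ × ℝ × ℝ → ℝ}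
    (h : EqOn F G {z | (z.1, z.2.1) ∈ Ω}) (hz : (z.1, z.2.1) ∈ Ω) : pu F z = pu G z := by
  rw [pu, pu, (h.eventuallyEq_of_mem ((isOpen_cylinder hΩ).mem_nhds hz)).fderiv_eq]

theorem field_τ (q : Coeffs) : q.field.τ = fun _ => 1 := rfl

theorem field_ξ (q : Coeffs) :
    q.field.ξ = cubic q.ξ₀ (fun _ => -(1 / 2)) (fun _ => 0) (fun _ => 0) := by
  funext z
  simp only [Coeffs.field, cubic]
  ring

theorem field_η (q : Coeffs) :
    q.field.η = cubic q.η₀ q.η₁ (fun p => -(1 / 2) * q.ξ₀ p) (fun _ => 1 / 4) := by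
  funext z
  simp only [Coeffs.field, cubic]
  ring

/-- The conditional invariance criterion for a vector field of the no-go form. -/
theorem prolongL_field (hΩ : IsOpen Ω) (hq : q.IsSmooth Ω) {j : Jet} (hj : (j.t, j.x) ∈ Ω)
    (hL : burgersL j = 0) (hQ : q.field.char j = 0) :
    q.field.prolongL j =
      (dt q.η₀ (j.t, j.x) + dx (dx q.η₀) (j.t, j.x) + 2 * dx q.ξ₀ (j.t, j.x) * q.η₀ (j.t, j.x))
      + (dt q.η₁ (j.t, j.x) + dx (dx q.η₁) (j.t, j.x) + 2 * dx q.ξ₀ (j.t, j.x) * q.η₁ (j.t, j.x)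
        + dx q.η₀ (j.t, j.x)) * j.u
      - (dt q.ξ₀ (j.t, j.x) + dx (dx q.ξ₀) (j.t, j.x)
        + 2 * q.ξ₀ (j.t, j.x) * dx q.ξ₀ (j.t, j.x) - 2 * dx q.η₁ (j.t, j.x))
        * (j.ux + 1 / 2 * j.u ^ 2) := by
  have c : ∀ k : ℝ, ContDiffOn ℝ ∞ (fun _ : ℝ × ℝ => k) Ω := fun k => contDiffOn_const
  have hξ := hq.ξ₀
  have hξ' := contDiffOn_dx hΩ hξ
  have hs : ContDiffOn ℝ ∞ (fun p => -(1 / 2) * q.ξ₀ p) Ω := (c _).mul hξ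
  have hz : (j.base.1, j.base.2.1) ∈ Ω := hj
  have dξ := differentiableAt_of_contDiffOn hΩ hξ hj
  have dξ' := differentiableAt_of_contDiffOn hΩ hξ' hj
  have hdx0 : ∀ k : ℝ, dx (fun _ : ℝ × ℝ => k) = fun _ => 0 := fun k => funext fun p => dx_const k
  have es : EqOn (dx fun p => -(1 / 2) * q.ξ₀ p) (fun p => -(1 / 2) * dx q.ξ₀ p) Ω := fun p hp => by
    have := differentiableAt_of_contDiffOn hΩ hξ hp
    simp (disch := fun_prop) only [dx_mul, dx_const]
    ring
  have es' : dx (dx fun p => -(1 / 2) * q.ξ₀ p) (j.t, j.x) =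
      -(1 / 2) * dx (dx q.ξ₀) (j.t, j.x) := by
    rw [dx_congr hΩ es hj]
    simp (disch := fun_prop) only [dx_mul, dx_const]
    ring
  have et : dt (fun p => -(1 / 2) * q.ξ₀ p) (j.t, j.x) = -(1 / 2) * dt q.ξ₀ (j.t, j.x) := by
    simp (disch := fun_prop) only [dt_mul, dt_const]
    ring
  have ηt := pt_cubic hΩ hq.η₀ hq.η₁ hs (c (1 / 4)) hz
  have ηx : EqOn (px (cubic q.η₀ q.η₁ (fun p => -(1 / 2) * q.ξ₀ p) (fun _ => 1 / 4)))
      (cubic (dx q.η₀) (dx q.η₁) (dx fun p => -(1 / 2) * q.ξ₀ p) (dx fun _ => 1 / 4))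
      {z | (z.1, z.2.1) ∈ Ω} := fun z hz => px_cubic hΩ hq.η₀ hq.η₁ hs (c (1 / 4)) hz
  have ηu : EqOn (pu (cubic q.η₀ q.η₁ (fun p => -(1 / 2) * q.ξ₀ p) (fun _ => 1 / 4)))
      (cubic q.η₁ (fun p => 2 * (-(1 / 2) * q.ξ₀ p)) (fun _ => 3 * (1 / 4)) fun _ => 0)
      {z | (z.1, z.2.1) ∈ Ω} := fun z hz => pu_cubic hΩ hq.η₀ hq.η₁ hs (c (1 / 4)) hz
  have ξt := pt_cubic hΩ hξ (c (-(1 / 2))) (c 0) (c 0) hz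
  have ξx : EqOn (px (cubic q.ξ₀ (fun _ => -(1 / 2)) (fun _ => 0) (fun _ => 0)))
      (cubic (dx q.ξ₀) (dx fun _ => -(1 / 2)) (dx fun _ => 0) (dx fun _ => 0))
      {z | (z.1, z.2.1) ∈ Ω} := fun z hz => px_cubic hΩ hξ (c (-(1 / 2))) (c 0) (c 0) hz
  have ξu : EqOn (pu (cubic q.ξ₀ (fun _ => -(1 / 2)) (fun _ => 0) (fun _ => 0)))
      (cubic (fun _ => -(1 / 2)) (fun _ => 2 * 0) (fun _ => 3 * 0) fun _ => 0)
      {z | (z.1, z.2.1) ∈ Ω} := fun z hz => pu_cubic hΩ hξ (c (-(1 / 2))) (c 0) (c 0) hz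
  have c' : ∀ k : ℝ, ContDiffOn ℝ ∞ (dx fun _ : ℝ × ℝ => k) Ω := fun k => by
    rw [hdx0]; exact c 0
  have hη₀' := contDiffOn_dx hΩ hq.η₀
  have hη₁' := contDiffOn_dx hΩ hq.η₁
  have hs' := contDiffOn_dx hΩ hs
  have ηxx := (px_congr hΩ ηx hz).trans (px_cubic hΩ hη₀' hη₁' hs' (c' _) hz)
  have ηux := (pu_congr hΩ ηx hz).trans (pu_cubic hΩ hη₀' hη₁' hs' (c' _) hz)
  have ηuu := (pu_congr hΩ ηu hz).trans (pu_cubic hΩ hq.η₁ ((c 2).mul hs) (c _) (c 0) hz)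
  have ξxx := (px_congr hΩ ξx hz).trans (px_cubic hΩ hξ' (c' _) (c' _) (c' _) hz)
  have ξux := (pu_congr hΩ ξx hz).trans (pu_cubic hΩ hξ' (c' _) (c' _) (c' _) hz)
  have ξuu := (pu_congr hΩ ξu hz).trans (pu_cubic hΩ (c _) (c _) (c _) (c 0) hz)
  -- Since `τ` is constant, `u_tx` drops out of the prolonged equation. Hence `D_t Q = 0` and `D_x Q
  -- = 0` are not needed for the reduction.
  have hpx1 : px (fun _ => (1 : ℝ)) = fun _ => 0 := by funext z; simp [px]
  have hpu1 : pu (fun _ => (1 : ℝ)) = fun _ => 0 := by funext z; simp [pu]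
  have hpt1 : pt (fun _ => (1 : ℝ)) = fun _ => 0 := by funext z; simp [pt]
  have hpx0 : px (fun _ => (0 : ℝ)) = fun _ => 0 := by funext z; simp [px]
  have hpu0 : pu (fun _ => (0 : ℝ)) = fun _ => 0 := by funext z; simp [pu]
  have hut : j.ut = q.field.η j.base - q.field.ξ j.base * j.ux := by
    have : q.field.η j.base - 1 * j.ut - q.field.ξ j.base * j.ux = 0 := hQ
    linarith
  have huxx : j.uxx = -j.ut - j.u * j.ux := by
    have : j.ut + j.u * j.ux + j.uxx = 0 := hL
    linarith
  simp only [VField.prolongL, VField.prolT, VField.prolX, VField.prolXX, totalT, totalX, totalXX,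
    field_τ, hpx1, hpu1, hpt1, hpx0, hpu0]
  rw [huxx, hut]
  simp only [field_η, field_ξ, ηxx, ηux, ηuu, ξxx, ξux, ξuu, ηt, ξt, ηx hz, ηu hz, ξx hz, ξu hz]
  simp only [cubic, Jet.base, hdx0, es', et, es hj, dt_const]
  ring

theorem isReductionOperator_of_isDetermining (hΩ : IsOpen Ω) (hq : q.IsSmooth Ω)
    (h : ∀ p ∈ Ω, q.IsDetermining p) : q.field.IsReductionOperator Ω := by
  refine ⟨contDiffOn_const, ?_, ?_, fun t x u _ => Or.inl one_ne_zero, fun j hj hL hQ _ _ => ?_⟩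
  · rw [field_ξ]
    exact contDiffOn_cubic hq.ξ₀ contDiffOn_const contDiffOn_const contDiffOn_const
  · rw [field_η]
    exact contDiffOn_cubic hq.η₀ hq.η₁ (contDiffOn_const.mul hq.ξ₀) contDiffOn_const
  · rw [prolongL_field hΩ hq hj hL hQ, (h _ hj).ξ₀, (h _ hj).η₁, (h _ hj).η₀]
    ring

/-- The coordinates `(t, x, u, u_x)` are free: as `τ = 1`, the constraints are solved successively
for `u_t`, `u_xx`, `u_tx` and `u_tt`. -/
theorem exists_jet (q : Coeffs) (p : ℝ × ℝ) (u ux : ℝ) : ∃ j : Jet, (j.t, j.x) = p ∧ j.u = u ∧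
    j.ux = ux ∧ burgersL j = 0 ∧ q.field.char j = 0 ∧ q.field.charT j = 0 ∧
    q.field.charX j = 0 := by
  let z : ℝ × ℝ × ℝ := (p.1, p.2, u)
  let ut := q.field.η z - q.field.ξ z * ux
  let uxx := -ut - u * ux
  -- The zeros are placeholders: `totalT` and `totalX` read only first-order coordinates.
  let j₀ : Jet := ⟨p.1, p.2, u, ut, ux, 0, 0, uxx⟩
  let utx := totalX q.field.η j₀ - totalX q.field.τ j₀ * ut - totalX q.field.ξ j₀ * ux
    - q.field.ξ z * uxx
  let utt := totalT q.field.η j₀ - totalT q.field.τ j₀ * ut - totalT q.field.ξ j₀ * ux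
    - q.field.ξ z * utx
  refine ⟨⟨p.1, p.2, u, ut, ux, utt, utx, uxx⟩, rfl, rfl, rfl, ?_, ?_, ?_, ?_⟩
  · simp only [burgersL, uxx]
    ring
  · change q.field.η z - 1 * ut - q.field.ξ z * ux = 0
    simp only [ut]
    ring
  · change totalT q.field.η j₀ - totalT q.field.τ j₀ * ut - 1 * utt
      - totalT q.field.ξ j₀ * ux - q.field.ξ z * utx = 0
    simp only [utt]
    ring
  · change totalX q.field.η j₀ - totalX q.field.τ j₀ * ut - 1 * utx
      - totalX q.field.ξ j₀ * ux - q.field.ξ z * uxx = 0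
    simp only [utx]
    ring

theorem isDetermining_of_isReductionOperator (hΩ : IsOpen Ω) (hq : q.IsSmooth Ω)
    (h : q.field.IsReductionOperator Ω) {p : ℝ × ℝ} (hp : p ∈ Ω) : q.IsDetermining p := by
  have key : ∀ u ux : ℝ,
      (dt q.η₀ p + dx (dx q.η₀) p + 2 * dx q.ξ₀ p * q.η₀ p)
      + (dt q.η₁ p + dx (dx q.η₁) p + 2 * dx q.ξ₀ p * q.η₁ p + dx q.η₀ p) * u
      - (dt q.ξ₀ p + dx (dx q.ξ₀) p + 2 * q.ξ₀ p * dx q.ξ₀ p - 2 * dx q.η₁ p)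
        * (ux + 1 / 2 * u ^ 2) = 0 := by
    intro u ux
    obtain ⟨j, rfl, rfl, rfl, hL, hQ, hT, hX⟩ := exists_jet q p u ux
    rw [← prolongL_field hΩ hq hp hL hQ]
    exact h.criterion j hp hL hQ hT hX
  -- These three choices of `(u, u_x)` separate the coefficients of the polynomial.
  have h0 := key 0 0
  have h1 := key 0 1
  have h2 := key 1 0
  exact ⟨by linarith, by linarith, by linarith⟩

end Criterion

/-! ### Flatness and existence of a fundamental system -/

section Existence

variable {q : Coeffs} {Ω : Set (ℝ × ℝ)}

/-- A square matrix as an element of the Banach algebra of continuous linear endomorphisms. -/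
noncomputable def toEnd :
    Matrix (Fin 3) (Fin 3) ℝ →ₗ[ℝ] ((Fin 3 → ℝ) →L[ℝ] (Fin 3 → ℝ)) :=
  (LinearMap.toContinuousLinearMap (𝕜 := ℝ) (E := Fin 3 → ℝ) (F' := Fin 3 → ℝ)).toLinearMap ∘ₗ
    (Matrix.toLin' (R := ℝ) (m := Fin 3) (n := Fin 3)).toLinearMap

theorem toEnd_apply (M : Matrix (Fin 3) (Fin 3) ℝ) (y : Fin 3 → ℝ) :
    toEnd M y = M.mulVec y := rfl

theorem toEnd_mul (M N : Matrix (Fin 3) (Fin 3) ℝ) : toEnd (M * N) = toEnd M * toEnd N := by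
  ext1 y
  simp [toEnd_apply]

theorem toEnd_eq_sum (M : Matrix (Fin 3) (Fin 3) ℝ) :
    toEnd M = ∑ i, ∑ j, M i j • toEnd (Matrix.single i j 1) := by
  conv_lhs => rw [Matrix.matrix_eq_sum_single M]
  simp only [map_sum, ← map_smul, Matrix.smul_single, smul_eq_mul, mul_one]

theorem contDiffOn_toEnd {M : ℝ × ℝ → Matrix (Fin 3) (Fin 3) ℝ}
    (hM : ∀ i j, ContDiffOn ℝ ∞ (fun p => M p i j) Ω) :
    ContDiffOn ℝ ∞ (fun p => toEnd (M p)) Ω := by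
  simp only [fun p => toEnd_eq_sum (M p)]
  exact ContDiffOn.sum fun i _ => ContDiffOn.sum fun j _ => (hM i j).smul contDiffOn_const

theorem fderiv_toEnd {M : ℝ × ℝ → Matrix (Fin 3) (Fin 3) ℝ} {p : ℝ × ℝ}
    (hM : ∀ i j, DifferentiableAt ℝ (fun p => M p i j) p) (e : ℝ × ℝ) :
    fderiv ℝ (fun p => toEnd (M p)) p e =
      toEnd (Matrix.of fun i j => fderiv ℝ (fun p => M p i j) p e) := by
  have h : HasFDerivAt (fun p => toEnd (M p)) (∑ i, ∑ j,
      (fderiv ℝ (fun p => M p i j) p).smulRight (toEnd (Matrix.single i j 1))) p := by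
    simp only [fun p => toEnd_eq_sum (M p)]
    exact HasFDerivAt.fun_sum fun i _ => HasFDerivAt.fun_sum fun j _ =>
      (hM i j).hasFDerivAt.smul_const (toEnd (Matrix.single i j 1))
  rw [h.fderiv, toEnd_eq_sum]
  simp

theorem contDiffOn_connX (hq : q.IsSmooth Ω) (i j : Fin 3) :
    ContDiffOn ℝ ∞ (fun p => q.connX p i j) Ω := by
  obtain ⟨h1, h2, h3⟩ := hq
  fin_cases i <;> fin_cases j <;> simp [Coeffs.connX] <;> fun_prop

theorem contDiffOn_connT (hΩ : IsOpen Ω) (hq : q.IsSmooth Ω) (i j : Fin 3) :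
    ContDiffOn ℝ ∞ (fun p => q.connT p i j) Ω := by
  have h1' := contDiffOn_dx hΩ hq.ξ₀
  have h2' := contDiffOn_dx hΩ hq.η₁
  have h3' := contDiffOn_dx hΩ hq.η₀
  obtain ⟨h1, h2, h3⟩ := hq
  fin_cases i <;> fin_cases j <;> simp [Coeffs.connT] <;> fun_prop

/-- The determining equations say that the connection of the linear system is flat. -/
theorem Coeffs.IsDetermining.flat (hΩ : IsOpen Ω) (hq : q.IsSmooth Ω) {p : ℝ × ℝ} (hp : p ∈ Ω)
    (h : q.IsDetermining p) (i j : Fin 3) :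
    dt (fun p => q.connX p i j) p + (q.connX p * q.connT p) i j =
      dx (fun p => q.connT p i j) p + (q.connT p * q.connX p) i j := by
  have dξ := differentiableAt_of_contDiffOn hΩ hq.ξ₀ hp
  have dη₁ := differentiableAt_of_contDiffOn hΩ hq.η₁ hp
  have dη₀ := differentiableAt_of_contDiffOn hΩ hq.η₀ hp
  have dξ' := differentiableAt_of_contDiffOn hΩ (contDiffOn_dx hΩ hq.ξ₀) hp
  have dη₁' := differentiableAt_of_contDiffOn hΩ (contDiffOn_dx hΩ hq.η₁) hp
  have dη₀' := differentiableAt_of_contDiffOn hΩ (contDiffOn_dx hΩ hq.η₀) hp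
  obtain ⟨h1, h2, h3⟩ := h
  fin_cases i <;> fin_cases j <;>
    simp [Coeffs.connX, Coeffs.connT, Matrix.mul_apply, Fin.sum_univ_three, -neg_mul] <;>
    simp (disch := fun_prop) only [div_eq_mul_inv, pow_two, dx_neg, dt_neg, dx_add, dx_sub, dx_mul,
      dt_mul, dx_const, dt_const]
  -- The first two rows of the curvature vanish identically. The third row contains the equations
  -- for `η⁰`, `η¹`, `ξ⁰` with factors `-1/2`, `-1`, `1`.
  all_goals first
    | ring1
    | linear_combination h1
    | linear_combination -h2
    | linear_combination -(1 / 2) * h3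

/-- The determining equations imply that the linear system has a fundamental system of solutions
on a simply connected open set. -/
theorem exists_isLinearSolution (hΩ : IsOpen Ω) (hΩ' : IsSimplyConnected Ω) (hq : q.IsSmooth Ω)
    (h : ∀ p ∈ Ω, q.IsDetermining p) :
    ∃ v : Fin 3 → ℝ × ℝ → ℝ, (∀ i, q.IsLinearSolution Ω (v i)) ∧
      ∀ p ∈ Ω, (jetMatrix v p).det ≠ 0 := by
  obtain ⟨Φ, hΦ, hΦd⟩ := exists_global_parallel hΩ hΩ' (fun p => toEnd (q.connX p))
    (fun p => toEnd (q.connT p)) (contDiffOn_toEnd (contDiffOn_connX hq))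
    (contDiffOn_toEnd (contDiffOn_connT hΩ hq)) (fun p hp => by
      rw [fderiv_toEnd fun i j => differentiableAt_of_contDiffOn hΩ (contDiffOn_connX hq i j) hp,
        fderiv_toEnd fun i j => differentiableAt_of_contDiffOn hΩ (contDiffOn_connT hΩ hq i j) hp,
        ← toEnd_mul, ← toEnd_mul, ← map_add, ← map_add]
      congr 1
      ext i j
      exact (h p hp).flat hΩ hq hp i j)
  -- Applying the operator-valued frame to basis vectors gives parallel vectors. The form of `M`
  -- makes them prolongations `(v, v_x, v_xx)` of their first components.
  let y : Fin 3 → Fin 3 → ℝ × ℝ → ℝ := fun i k p => Φ p (Pi.single i 1) k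
  have hd : ∀ i k, ∀ p ∈ Ω, HasFDerivAt (y i k)
      (((ContinuousLinearMap.proj k).comp (ContinuousLinearMap.apply ℝ (Fin 3 → ℝ)
        (Pi.single i 1 : Fin 3 → ℝ))).comp
        (parallelDeriv (fun p => toEnd (q.connX p)) (fun p => toEnd (q.connT p)) Φ p)) p :=
    fun i k p hp => ((ContinuousLinearMap.proj k).comp (ContinuousLinearMap.apply ℝ (Fin 3 → ℝ)
      (Pi.single i 1 : Fin 3 → ℝ))).hasFDerivAt.comp p (hΦd p hp).2
  have hyx : ∀ i k, ∀ p ∈ Ω, dx (y i k) p = ∑ l, q.connX p k l * y i l p := fun i k p hp => by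
    rw [dx, (hd i k p hp).fderiv]
    simp [parallelDeriv_apply, toEnd_apply, Matrix.mulVec, dotProduct, y]
  have hyt : ∀ i k, ∀ p ∈ Ω, dt (y i k) p = ∑ l, q.connT p k l * y i l p := fun i k p hp => by
    rw [dt, (hd i k p hp).fderiv]
    simp [parallelDeriv_apply, toEnd_apply, Matrix.mulVec, dotProduct, y]
  have hys : ∀ i k, ContDiffOn ℝ ∞ (y i k) Ω := fun i k =>
    contDiffOn_pi.1 (hΦ.clm_apply contDiffOn_const) k
  have hx0 : ∀ i, EqOn (dx (y i 0)) (y i 1) Ω := fun i p hp => by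
    rw [hyx i 0 p hp]; simp [Coeffs.connX, Fin.sum_univ_three]
  have hx1 : ∀ i, EqOn (dx (y i 1)) (y i 2) Ω := fun i p hp => by
    rw [hyx i 1 p hp]; simp [Coeffs.connX, Fin.sum_univ_three]
  have hxx : ∀ i, EqOn (dx (dx (y i 0))) (y i 2) Ω := fun i p hp => by
    rw [dx_congr hΩ (hx0 i) hp, hx1 i hp]
  refine ⟨fun i => y i 0, fun i => ⟨hys i 0, fun p hp => ?_, fun p hp => ?_⟩, fun p hp => ?_⟩
  · rw [hyt i 0 p hp, hxx i hp]
    simp [Coeffs.connT, Fin.sum_univ_three]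
  · rw [dx_congr hΩ (hxx i) hp, hxx i hp, hx0 i hp, hyx i 2 p hp]
    simp [Coeffs.connX, Fin.sum_univ_three]
    ring
  · have hm : jetMatrix (fun i => y i 0) p = Matrix.of fun i k => y i k p := by
      ext i k
      fin_cases k
      · rfl
      · exact hx0 i hp
      · exact hxx i hp
    rw [hm]
    intro hdet
    obtain ⟨c, hc, hc0⟩ := Matrix.exists_vecMul_eq_zero_iff.2 hdet
    apply hc
    -- A linear relation between the rows is a vector in the kernel of the invertible operator `Φ
    -- p`.
    have h1 : Φ p c = 0 := by
      have : c = ∑ i, c i • (Pi.single i 1 : Fin 3 → ℝ) := by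
        funext k; simp [Finset.sum_apply, Pi.single_apply]
      rw [this, map_sum]
      funext k
      rw [← hc0]
      simp [Matrix.vecMul, dotProduct, y]
    obtain ⟨a, ha⟩ := (hΦd p hp).1
    have h2 : ((a⁻¹ : ((Fin 3 → ℝ) →L[ℝ] (Fin 3 → ℝ))ˣ) : (Fin 3 → ℝ) →L[ℝ] (Fin 3 → ℝ)) *
      Φ p = 1 := by rw [← ha, Units.inv_mul]
    have h3 := congrArg (fun L : (Fin 3 → ℝ) →L[ℝ] (Fin 3 → ℝ) => L c) h2
    simpa [h1] using h3.symm

end Existence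

/-! ### Families of invariant solutions -/

section Families

variable {q : Coeffs} {Ω U : Set (ℝ × ℝ)} {v w : Fin 3 → ℝ × ℝ → ℝ}

theorem Coeffs.IsLinearSolution.mono {v : ℝ × ℝ → ℝ} (hv : q.IsLinearSolution Ω v) (h : U ⊆ Ω) :
    q.IsLinearSolution U v :=
  ⟨hv.smooth.mono h, fun p hp => hv.heat p (h hp), fun p hp => hv.third p (h hp)⟩

theorem Coeffs.IsProjParallel.mono {lam mu : ℝ × ℝ → ℝ} {y : Fin 3 → ℝ × ℝ → ℝ}
    (hy : q.IsProjParallel Ω lam mu y) (h : U ⊆ Ω) : q.IsProjParallel U lam mu y :=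
  ⟨fun k p hp => hy.diff k p (h hp), fun k p hp => hy.eqX k p (h hp),
    fun k p hp => hy.eqT k p (h hp)⟩

theorem contDiffOn_comb (hv : ∀ i, ContDiffOn ℝ ∞ (v i) Ω) (c : Fin 3 → ℝ) :
    ContDiffOn ℝ ∞ (comb v c) Ω :=
  ContDiffOn.sum fun i _ => contDiffOn_const.mul (hv i)

theorem dx_comb (hΩ : IsOpen Ω) (hv : ∀ i, ContDiffOn ℝ ∞ (v i) Ω) (c : Fin 3 → ℝ) :
    EqOn (dx (comb v c)) (comb (fun i => dx (v i)) c) Ω := fun p hp => by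
  refine (dx_sum_mul (f := fun i _ => c i) (fun i => differentiableAt_const _)
    (fun i => differentiableAt_of_contDiffOn hΩ (hv i) hp)).trans ?_
  simp [dx_const, comb]

theorem dt_comb (hΩ : IsOpen Ω) (hv : ∀ i, ContDiffOn ℝ ∞ (v i) Ω) (c : Fin 3 → ℝ) :
    EqOn (dt (comb v c)) (comb (fun i => dt (v i)) c) Ω := fun p hp => by
  refine (dt_sum_mul (f := fun i _ => c i) (fun i => differentiableAt_const _)
    (fun i => differentiableAt_of_contDiffOn hΩ (hv i) hp)).trans ?_
  simp [dt_const, comb]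

theorem dx_iterate_comb (hΩ : IsOpen Ω) (hv : ∀ i, ContDiffOn ℝ ∞ (v i) Ω) (c : Fin 3 → ℝ)
    (k : ℕ) : EqOn (dx^[k] (comb v c)) (comb (fun i => dx^[k] (v i)) c) Ω := by
  induction k with
  | zero => exact fun p _ => rfl
  | succ k ih =>
    intro p hp
    simp only [Function.iterate_succ_apply']
    rw [dx_congr hΩ ih hp, dx_comb hΩ (fun i => contDiffOn_iterate_dx hΩ (hv i) k) c hp]

theorem ratio_eq (hΩ : IsOpen Ω) (hv : ∀ i, ContDiffOn ℝ ∞ (v i) Ω) (c : Fin 3 → ℝ) {p : ℝ × ℝ}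
    (hp : p ∈ Ω) : ratio v c p = 2 * dx (comb v c) p / comb v c p := by
  rw [dx_comb hΩ hv c hp]
  rfl

theorem isLinearSolution_comb (hΩ : IsOpen Ω) (hv : ∀ i, q.IsLinearSolution Ω (v i))
    (c : Fin 3 → ℝ) : q.IsLinearSolution Ω (comb v c) := by
  have hs := fun i => (hv i).smooth
  have h2 := dx_iterate_comb hΩ hs c 2
  have h3 := dx_iterate_comb hΩ hs c 3
  simp only [Function.iterate_succ_apply', Function.iterate_zero_apply] at h2 h3
  refine ⟨contDiffOn_comb hs c, fun p hp => ?_, fun p hp => ?_⟩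
  · rw [dt_comb hΩ hs c hp, h2 hp, comb, comb, ← Finset.sum_add_distrib]
    exact Finset.sum_eq_zero fun i _ => by rw [← mul_add, (hv i).heat p hp, mul_zero]
  · rw [h3 hp, h2 hp, dx_comb hΩ hs c hp]
    simp only [comb, Fin.sum_univ_three, (hv _).third p hp]
    ring

theorem vecMul_jetMatrix (v : Fin 3 → ℝ × ℝ → ℝ) (c : Fin 3 → ℝ) (p : ℝ × ℝ) (k : Fin 3) :
    Matrix.vecMul c (jetMatrix v p) k = comb (fun i => dx^[k] (v i)) c p := rfl

theorem isSubdomain_ball {p : ℝ × ℝ} {r : ℝ} (hr : 0 < r) (h : ball p r ⊆ Ω) :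
    IsSubdomain Ω (ball p r) :=
  ⟨h, isOpen_ball, (convex_ball p r).isConnected (nonempty_ball.2 hr)⟩

theorem exists_subdomain_of_ne_zero (hΩ : IsOpen Ω) {f : ℝ × ℝ → ℝ} (hf : ContinuousOn f Ω)
    {p : ℝ × ℝ} (hp : p ∈ Ω) (h : f p ≠ 0) :
    ∃ U, IsSubdomain Ω U ∧ p ∈ U ∧ ∀ x ∈ U, f x ≠ 0 := by
  have hc := hf.continuousAt (hΩ.mem_nhds hp)
  obtain ⟨r, hr, hrs⟩ := Metric.eventually_nhds_iff_ball.1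
    ((hΩ.eventually_mem hp).and (hc.eventually_ne h))
  exact ⟨ball p r, isSubdomain_ball hr fun x hx => (hrs x hx).1, mem_ball_self hr,
    fun x hx => (hrs x hx).2⟩

theorem isNoGoOperator_wronskianCoeffs (hΩ : IsOpen Ω) (hv : IsHeatTriple Ω v) :
    IsNoGoOperator Ω (wronskianCoeffs Ω v) := by
  have hs := wronskianCoeffs_isSmooth hΩ hv
  refine ⟨hs.ξ₀, hs.η₁, hs.η₀, fun p hp => ?_,
    isReductionOperator_of_isDetermining hΩ hs fun p hp =>
      isDetermining_of_isLinearSolution hs hΩ (hv.isLinearSolution hΩ)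
        (fun p hp => hv.det_ne_zero hp) hp⟩
  simp [wronskianCoeffs, hp]

theorem IsNoGoOperator.isSmooth (hq : IsNoGoOperator Ω q) : q.IsSmooth Ω :=
  ⟨hq.smooth_ξ₀, hq.smooth_η₁, hq.smooth_η₀⟩

/-- Invertibility of the parallel frame is the nonvanishing of the Wronskian, and the coefficients
are recovered from the frame by Cramer's rule. -/
theorem IsNoGoOperator.exists_heatTriple (hΩ : IsOpen Ω) (hΩ' : IsSimplyConnected Ω)
    (hq : IsNoGoOperator Ω q) : ∃ v, IsHeatTriple Ω v ∧ q = wronskianCoeffs Ω v := by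
  obtain ⟨v, hv, hdet⟩ := exists_isLinearSolution hΩ hΩ' hq.isSmooth fun p hp =>
    isDetermining_of_isReductionOperator hΩ hq.isSmooth hq.reduction hp
  have hT : IsHeatTriple Ω v := ⟨fun i => (hv i).smooth, fun i => (hv i).heat, fun p hp => by
    rw [wronskian_eq_det_jetMatrix]; exact hdet p hp⟩
  exact ⟨v, hT, eq_wronskianCoeffs_of_isLinearSolution hΩ hT hv hq.zero_off⟩

theorem invariantFamily_wronskianCoeffs (hΩ : IsOpen Ω) (hv : IsHeatTriple Ω v) :
    invariantFamily Ω (wronskianCoeffs Ω v) = ratioFamily Ω v := by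
  have hs := wronskianCoeffs_isSmooth hΩ hv
  have hl := hv.isLinearSolution hΩ
  ext ⟨U, u⟩
  constructor
  · rintro ⟨hU, hu, hLQ⟩
    refine ⟨hU, ?_⟩
    have hy := isProjParallel_logSection (hs.mono hU.1) hU.2.1 hu (fun p hp => (hLQ p hp).1)
      (fun p hp => (hLQ p hp).2)
    obtain ⟨k, hk, h, hh⟩ := hy.exists_const_direction hU.2.1 hU.2.2
      (V := fun i k => dx^[k] (v i)) (fun i => ((hl i).isProjParallel hs hΩ).mono hU.1)
      (fun p hp => hv.det_ne_zero (hU.1 hp)) (fun p _ => ⟨0, one_ne_zero⟩)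
    refine ⟨k, hk, fun p hp => ?_⟩
    -- The first entry of the section is `1`, so the denominator cannot vanish; the quotient of the
    -- second entry by the first is `u/2`.
    have h0 : h p * comb v k p = 1 := hh p hp 0
    have h1 : h p * ∑ i, k i * dx (v i) p = 1 / 2 * u p := hh p hp 1
    have hne : comb v k p ≠ 0 := right_ne_zero_of_mul_eq_one h0
    refine ⟨hne, ?_⟩
    change u p = ratio v k p
    rw [ratio, eq_div_iff hne]
    linear_combination (-2 * comb v k p) * h1 + 2 * (∑ i, k i * dx (v i) p) * h0
  · rintro ⟨hU, c, hc, h⟩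
    exact ⟨hU, Coeffs.IsLinearSolution.invariant hU.2.1 ((isLinearSolution_comb hΩ hl c).mono hU.1)
      (fun p hp => (h p hp).1)
      (fun p hp => by rw [(h p hp).2, ratio_eq hΩ hv.smooth c (hU.1 hp)])⟩

/-- The first-order jet of a member of the family of a triple, in terms of the denominator. -/
theorem dx_ratio (hΩ : IsOpen Ω) (hv : ∀ i, ContDiffOn ℝ ∞ (v i) Ω) (hU : IsSubdomain Ω U)
    {c : Fin 3 → ℝ} (hc : ∀ p ∈ U, comb v c p ≠ 0) {p : ℝ × ℝ} (hp : p ∈ U) :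
    ratio v c p * comb v c p = 2 * dx (comb v c) p ∧
    dx (ratio v c) p * comb v c p + ratio v c p * dx (comb v c) p = 2 * dx (dx (comb v c)) p := by
  have hw := (contDiffOn_comb hv c).mono hU.1
  have hw' := contDiffOn_dx hU.2.1 hw
  have hr : EqOn (ratio v c) (fun p => 2 * dx (comb v c) p / comb v c p) U := fun p hp =>
    ratio_eq hΩ hv c (hU.1 hp)
  have hu : ContDiffOn ℝ ∞ (ratio v c) U := ((contDiffOn_const.mul hw').div hw hc).congr hr
  have e0 : EqOn (fun p => ratio v c p * comb v c p) (fun p => 2 * dx (comb v c) p) U :=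
    fun p hp => by
      change ratio v c p * comb v c p = _
      rw [hr hp, div_mul_cancel₀ _ (hc p hp)]
  refine ⟨e0 hp, ?_⟩
  have du := differentiableAt_of_contDiffOn hU.2.1 hu hp
  have dw := differentiableAt_of_contDiffOn hU.2.1 hw hp
  have dw' := differentiableAt_of_contDiffOn hU.2.1 hw' hp
  have h := dx_congr hU.2.1 e0 hp
  simp (disch := fun_prop) only [dx_mul, dx_const] at h
  linarith

/-- Every first-order jet is attained by a member of the family of a triple. -/
theorem exists_ratio_jet (hΩ : IsOpen Ω) (hv : IsHeatTriple Ω v) {p : ℝ × ℝ} (hp : p ∈ Ω)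
    (a b : ℝ) : ∃ s ∈ ratioFamily Ω v, p ∈ s.1 ∧ s.2 p = a ∧ dx s.2 p = b := by
  -- This is the jet `(w, w_x, w_xx)` normalized by `w = 1` for which `2 w_x / w` has value `a` and
  -- `x`-derivative `b`; invertibility of the jet matrix realizes it by constants.
  let y : Fin 3 → ℝ := ![1, a / 2, b / 2 + a ^ 2 / 4]
  let c := Matrix.vecMul y (jetMatrix v p)⁻¹
  have hc : Matrix.vecMul c (jetMatrix v p) = y := by
    rw [Matrix.vecMul_vecMul, Matrix.nonsing_inv_mul _ (isUnit_iff_ne_zero.2 (hv.det_ne_zero hp)),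
      Matrix.vecMul_one]
  have hk : ∀ k : Fin 3, dx^[k] (comb v c) p = y k := fun k => by
    rw [dx_iterate_comb hΩ hv.smooth c k hp, ← vecMul_jetMatrix, hc]
  have h0 : comb v c p = 1 := hk 0
  have h1 : dx (comb v c) p = a / 2 := hk 1
  have h2 : dx (dx (comb v c)) p = b / 2 + a ^ 2 / 4 := hk 2
  obtain ⟨U, hU, hpU, hne⟩ := exists_subdomain_of_ne_zero hΩ
    (contDiffOn_comb hv.smooth c).continuousOn hp (by rw [h0]; exact one_ne_zero)
  obtain ⟨e0, e1⟩ := dx_ratio hΩ hv.smooth hU hne hpU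
  rw [h0, h1] at e0 e1
  rw [h2] at e1
  have e0' : ratio v c p = a := by linarith
  rw [e0'] at e1
  refine ⟨(U, ratio v c), ⟨hU, c, fun h => ?_, fun p hp => ⟨hne p hp, rfl⟩⟩, hpU, e0', by linarith⟩
  rw [h] at h0
  simp [comb] at h0

/-- A common member is invariant under both operators, and subtracting the two characteristics
eliminates `u_t`. As `(u, u_x)` takes every value at each point, the resulting polynomial identity
forces equal coefficients. -/
theorem wronskianCoeffs_eq_of_ratioFamily_eq (hΩ : IsOpen Ω) (hv : IsHeatTriple Ω v)
    (hw : IsHeatTriple Ω w) (h : ratioFamily Ω v = ratioFamily Ω w) :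
    wronskianCoeffs Ω v = wronskianCoeffs Ω w := by
  have key : ∀ p ∈ Ω, ∀ a b : ℝ,
      -((wronskianCoeffs Ω v).ξ₀ p - (wronskianCoeffs Ω w).ξ₀ p) * (a ^ 2 / 2 + b)
      + ((wronskianCoeffs Ω v).η₁ p - (wronskianCoeffs Ω w).η₁ p) * a
      + ((wronskianCoeffs Ω v).η₀ p - (wronskianCoeffs Ω w).η₀ p) = 0 := by
    intro p hp a b
    obtain ⟨s, hs, hps, ha, hb⟩ := exists_ratio_jet hΩ hv hp a b
    have hsw := h ▸ hs
    rw [← invariantFamily_wronskianCoeffs hΩ hv] at hs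
    rw [← invariantFamily_wronskianCoeffs hΩ hw] at hsw
    have e1 := (hs.2.2 p hps).2
    have e2 := (hsw.2.2 p hps).2
    rw [char_jet, ha, hb] at e1 e2
    linear_combination e1 - e2
  ext p
  all_goals
    by_cases hp : p ∈ Ω
    · have k1 := key p hp 0 0
      have k2 := key p hp 0 1
      have k3 := key p hp 1 0
      linarith
    · simp [wronskianCoeffs, hp]

/-- Since `c · (A v) = (c A) · v`, the parameters change by `c ↦ c A`, which preserves `c ≠ 0`. The
reverse inclusion follows with `A⁻¹`. -/
theorem ratioFamily_subset_of_linear (hΩ : IsOpen Ω) (hv : ∀ i, ContDiffOn ℝ ∞ (v i) Ω)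
    {A : Matrix (Fin 3) (Fin 3) ℝ} (hA : A.det ≠ 0) (h : ∀ p ∈ Ω, ∀ i, w i p = ∑ j, A i j * v j p) :
    ratioFamily Ω w ⊆ ratioFamily Ω v := by
  have hx : ∀ p ∈ Ω, ∀ i, dx (w i) p = ∑ j, A i j * dx (v j) p := fun p hp i =>
    (dx_congr hΩ (fun p hp => h p hp i) hp).trans (dx_comb hΩ hv (A i) hp)
  have hsum : ∀ (c f g : Fin 3 → ℝ), (∀ i, f i = ∑ j, A i j * g j) →
      ∑ i, c i * f i = ∑ j, Matrix.vecMul c A j * g j := by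
    intro c f g hfg
    simp only [hfg, Matrix.vecMul, dotProduct, Finset.mul_sum, Finset.sum_mul]
    rw [Finset.sum_comm]
    simp only [mul_assoc]
  rintro ⟨U, u⟩ ⟨hU, c, hc, hcu⟩
  refine ⟨hU, Matrix.vecMul c A, fun h0 => hc (Matrix.eq_zero_of_vecMul_eq_zero hA h0),
    fun p hp => ?_⟩
  have e1 : comb w c p = comb v (Matrix.vecMul c A) p := hsum c _ _ (h p (hU.1 hp))
  have e2 := hsum c _ _ (hx p (hU.1 hp))
  obtain ⟨h1, h2⟩ := hcu p hp
  rw [e1] at h1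
  rw [ratio, e1, e2] at h2
  exact ⟨h1, h2⟩

theorem ratioFamily_eq_of_linear (hΩ : IsOpen Ω) (hv : ∀ i, ContDiffOn ℝ ∞ (v i) Ω)
    (hw : ∀ i, ContDiffOn ℝ ∞ (w i) Ω) {A : Matrix (Fin 3) (Fin 3) ℝ} (hA : A.det ≠ 0)
    (h : ∀ p ∈ Ω, ∀ i, w i p = ∑ j, A i j * v j p) : ratioFamily Ω v = ratioFamily Ω w := by
  refine Subset.antisymm (ratioFamily_subset_of_linear hΩ hw (A := A⁻¹) ?_ fun p hp i => ?_)
    (ratioFamily_subset_of_linear hΩ hv hA h)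
  · rw [Matrix.det_nonsing_inv, Ring.inverse_eq_inv']
    exact inv_ne_zero hA
  · have h1 : (fun i => w i p) = A.mulVec fun j => v j p := funext fun i => h p hp i
    have h2 : A⁻¹.mulVec (fun i => w i p) = fun j => v j p := by
      rw [h1, Matrix.mulVec_mulVec, Matrix.nonsing_inv_mul _ (isUnit_iff_ne_zero.2 hA),
        Matrix.one_mulVec]
    exact (congrFun h2 i).symm

/-- Both triples are parallel frames of one connection, so the coordinates of one in the other have
zero derivative and are constant on the connected set `Ω`. -/
theorem exists_linear_of_wronskianCoeffs_eq (hΩ : IsOpen Ω) (hΩc : IsConnected Ω)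
    (hv : IsHeatTriple Ω v) (hw : IsHeatTriple Ω w)
    (h : wronskianCoeffs Ω v = wronskianCoeffs Ω w) :
    ∃ A : Matrix (Fin 3) (Fin 3) ℝ, A.det ≠ 0 ∧ ∀ p ∈ Ω, ∀ i, w i p = ∑ j, A i j * v j p := by
  have hs := wronskianCoeffs_isSmooth hΩ hv
  have hlw := hw.isLinearSolution hΩ
  rw [← h] at hlw
  have hp := fun i => (hlw i).isProjParallel hs hΩ
  have hex := fun i => (hp i).exists_coords hΩ (V := fun i k => dx^[k] (v i))
    (fun i => (hv.isLinearSolution hΩ i).isProjParallel hs hΩ) (fun p hp => hv.det_ne_zero hp)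
  choose c hc hcx hct hcV using hex
  obtain ⟨p₀, hp₀⟩ := hΩc.nonempty
  have hconst : ∀ i j, ∀ p ∈ Ω, c i j p = c i j p₀ := fun i j p hp =>
    eq_of_dt_dx_eq_zero hΩ hΩc.isPreconnected (hc i j)
      (fun p hp => by rw [hct i j p hp]; simp) (fun p hp => by rw [hcx i j p hp]; simp) hp hp₀
  refine ⟨Matrix.of fun i j => c i j p₀, fun hdet => ?_, fun p hp i => ?_⟩
  · have hm : jetMatrix w p₀ = (Matrix.of fun i j => c i j p₀) * jetMatrix v p₀ := by
      ext i k
      rw [Matrix.mul_apply]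
      exact (hcV i k p₀ hp₀).symm
    exact hw.det_ne_zero hp₀ (by rw [hm, Matrix.det_mul, hdet, zero_mul])
  · simp only [Matrix.of_apply, ← hconst i _ p hp]
    exact (hcV i 0 p hp).symm

/-- If the combination vanished identically, so would its `x`-derivatives, and `c` would annihilate
the invertible jet matrix. -/
theorem IsHeatTriple.exists_subdomain_comb_ne_zero (hΩ : IsOpen Ω) (hne : Ω.Nonempty)
    (hv : IsHeatTriple Ω v) {c : Fin 3 → ℝ} (hc : c ≠ 0) :
    ∃ U, IsSubdomain Ω U ∧ ∀ p ∈ U, comb v c p ≠ 0 := by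
  obtain ⟨p, hp, h⟩ : ∃ p ∈ Ω, comb v c p ≠ 0 := by
    by_contra! h
    obtain ⟨p, hp⟩ := hne
    refine hc (Matrix.eq_zero_of_vecMul_eq_zero (hv.det_ne_zero hp) (funext fun k => ?_))
    have hz : ∀ n, EqOn (dx^[n] (comb v c)) (fun _ => 0) Ω := by
      intro n
      induction n with
      | zero => exact h
      | succ n ih =>
        intro p hp
        rw [Function.iterate_succ_apply', dx_congr hΩ ih hp, dx_const]
    rw [vecMul_jetMatrix, ← dx_iterate_comb hΩ hv.smooth c k hp]
    exact hz k hp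
  obtain ⟨U, hU, -, h⟩ := exists_subdomain_of_ne_zero hΩ
    (contDiffOn_comb hv.smooth c).continuousOn hp h
  exact ⟨U, hU, h⟩

/-- At one point, `u` and `u_x` determine the jet `(w, w_x, w_xx)` of the denominator up to a
factor, and the jet determines the constants. The factor `k` is the quotient of the two denominators
there. -/
theorem IsHeatTriple.eqOn_ratio_iff (hΩ : IsOpen Ω) (hv : IsHeatTriple Ω v) {c d : Fin 3 → ℝ}
    (hU : IsSubdomain Ω U) (hc : ∀ p ∈ U, comb v c p ≠ 0) (hd : ∀ p ∈ U, comb v d p ≠ 0) :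
    EqOn (ratio v c) (ratio v d) U ↔ ∃ k : ℝ, k ≠ 0 ∧ d = k • c := by
  constructor
  · intro h
    obtain ⟨p, hp⟩ := hU.2.2.nonempty
    obtain ⟨c0, c1⟩ := dx_ratio hΩ hv.smooth hU hc hp
    obtain ⟨d0, d1⟩ := dx_ratio hΩ hv.smooth hU hd hp
    rw [← h hp] at d0 d1
    rw [← dx_congr hU.2.1 h hp] at d1
    have hcp := hc p hp
    have hdp := hd p hp
    let k := comb v d p / comb v c p
    have hk : k * comb v c p = comb v d p := div_mul_cancel₀ _ hcp
    have hk1 : k * dx (comb v c) p = dx (comb v d) p := by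
      linear_combination ratio v c p / 2 * hk - k / 2 * c0 + 1 / 2 * d0
    have hk2 : k * dx (dx (comb v c)) p = dx (dx (comb v d)) p := by
      linear_combination dx (ratio v c) p / 2 * hk + ratio v c p / 2 * hk1 - k / 2 * c1 + 1 / 2 * d1
    refine ⟨k, div_ne_zero hdp hcp, ?_⟩
    have hz := Matrix.eq_zero_of_vecMul_eq_zero (hv.det_ne_zero (hU.1 hp)) (v := d - k • c) (by
      rw [Matrix.sub_vecMul, Matrix.smul_vecMul]
      funext j
      simp only [Pi.sub_apply, Pi.smul_apply, vecMul_jetMatrix,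
        ← dx_iterate_comb hΩ hv.smooth _ _ (hU.1 hp), smul_eq_mul, Pi.zero_apply, sub_eq_zero]
      fin_cases j
      · exact hk.symm
      · exact hk1.symm
      · exact hk2.symm)
    exact sub_eq_zero.1 hz
  · rintro ⟨k, hk, rfl⟩ p hp
    have e : ∀ f : Fin 3 → ℝ, ∑ i, (k • c) i * f i = k * ∑ i, c i * f i := fun f => by
      rw [Finset.mul_sum]
      exact Finset.sum_congr rfl fun i _ => by simp [mul_assoc]
    have e1 : comb v (k • c) p = k * comb v c p := e _
    rw [ratio, ratio, e, e1]
    have := hc p hp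
    field_simp

end Families

end Burgers

end

/-! ### The main theorem -/

theorem mainTheorem3 (Ω : Set (ℝ × ℝ)) (hΩ : IsOpen Ω) (hΩ' : IsSimplyConnected Ω) :
    -- The Wronskian representation of a triple gives a reduction operator of the no-go form, and
    -- the family of the triple consists exactly of the solutions invariant under this operator.
    (∀ v, Burgers.IsHeatTriple Ω v →
      Burgers.IsNoGoOperator Ω (Burgers.wronskianCoeffs Ω v) ∧
      Burgers.invariantFamily Ω (Burgers.wronskianCoeffs Ω v) = Burgers.ratioFamily Ω v) ∧
    -- Every reduction operator of the no-go form arises in this way.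
    (∀ q, Burgers.IsNoGoOperator Ω q →
      ∃ v, Burgers.IsHeatTriple Ω v ∧ q = Burgers.wronskianCoeffs Ω v) ∧
    -- Two triples give the same family iff they give the same operator iff they are related by
    -- a constant nondegenerate linear transformation.
    (∀ v w, Burgers.IsHeatTriple Ω v → Burgers.IsHeatTriple Ω w →
      (Burgers.ratioFamily Ω v = Burgers.ratioFamily Ω w ↔
        Burgers.wronskianCoeffs Ω v = Burgers.wronskianCoeffs Ω w) ∧
      (Burgers.ratioFamily Ω v = Burgers.ratioFamily Ω w ↔
        ∃ A : Matrix (Fin 3) (Fin 3) ℝ, A.det ≠ 0 ∧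
          ∀ p ∈ Ω, ∀ i, w i p = ∑ j, A i j * v j p)) ∧
    -- Assigning to an operator the family of its invariant solutions is a bijection between
    -- the operators of the no-go form and the families of the triples.
    Set.BijOn (Burgers.invariantFamily Ω) {q | Burgers.IsNoGoOperator Ω q}
      {F | ∃ v, Burgers.IsHeatTriple Ω v ∧ F = Burgers.ratioFamily Ω v} ∧
    -- Each family has exactly two essential parameters: its members are parameterized
    -- bijectively by the points of the real projective plane.
    (∀ v, Burgers.IsHeatTriple Ω v →
      (∀ c : Fin 3 → ℝ, c ≠ 0 →
        ∃ U, Burgers.IsSubdomain Ω U ∧ ∀ p ∈ U, Burgers.comb v c p ≠ 0) ∧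
      (∀ (c d : Fin 3 → ℝ) (U : Set (ℝ × ℝ)), c ≠ 0 → d ≠ 0 → Burgers.IsSubdomain Ω U →
        (∀ p ∈ U, Burgers.comb v c p ≠ 0) → (∀ p ∈ U, Burgers.comb v d p ≠ 0) →
        (Set.EqOn (Burgers.ratio v c) (Burgers.ratio v d) U ↔
          ∃ k : ℝ, k ≠ 0 ∧ d = k • c))) := by
  have hinv := fun v (hv : Burgers.IsHeatTriple Ω v) =>
    Burgers.invariantFamily_wronskianCoeffs hΩ hv
  have hrep := fun q (hq : Burgers.IsNoGoOperator Ω q) => hq.exists_heatTriple hΩ hΩ'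
  have hiff : ∀ v w, Burgers.IsHeatTriple Ω v → Burgers.IsHeatTriple Ω w →
      (Burgers.ratioFamily Ω v = Burgers.ratioFamily Ω w ↔
        Burgers.wronskianCoeffs Ω v = Burgers.wronskianCoeffs Ω w) := fun v w hv hw =>
    ⟨Burgers.wronskianCoeffs_eq_of_ratioFamily_eq hΩ hv hw, fun h => by
      rw [← hinv v hv, h, hinv w hw]⟩
  refine ⟨fun v hv => ⟨Burgers.isNoGoOperator_wronskianCoeffs hΩ hv, hinv v hv⟩, hrep,
    fun v w hv hw => ⟨hiff v w hv hw, fun h =>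
      Burgers.exists_linear_of_wronskianCoeffs_eq hΩ hΩ'.isPathConnected.isConnected hv hw
        ((hiff v w hv hw).1 h),
      fun ⟨_, hA, h⟩ => Burgers.ratioFamily_eq_of_linear hΩ hv.smooth hw.smooth hA h⟩,
    ⟨fun q hq => ?_, fun q hq q' hq' h => ?_, ?_⟩,
    fun v hv => ⟨fun c hc => hv.exists_subdomain_comb_ne_zero hΩ hΩ'.nonempty hc,
      fun c d U _ _ hU hc hd => hv.eqOn_ratio_iff hΩ hU hc hd⟩⟩
  · obtain ⟨v, hv, rfl⟩ := hrep q hq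
    exact ⟨v, hv, hinv v hv⟩
  · obtain ⟨v, hv, rfl⟩ := hrep q hq
    obtain ⟨w, hw, rfl⟩ := hrep q' hq'
    rw [hinv v hv, hinv w hw] at h
    exact (hiff v w hv hw).1 h
  · rintro _ ⟨v, hv, rfl⟩
    exact ⟨_, Burgers.isNoGoOperator_wronskianCoeffs hΩ hv, hinv v hv⟩
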